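/- Let $X$ be a topological space and let $f:(\Lambda V,d)\xrightarrow{\simeq}A_{PL}(X)$ be a minimal Sullivan model of $X$ over $\mathbb{Q}$. That is, $\Lambda V$ is the free graded commutative $\mathbb{Q}$-algebra on a graded vector space $V=\bigoplus_{i\ge 1}V^i$, with a differential $d$ of degree $+1$ that is a derivation; $V$ has an exhaustive filtration by graded subspaces $0=V(-1)\subset V(0)\subset V(1)\subset\cdots$ with $dV(k)\subset\Lambda V(k-1)$; $dV\subset\Lambda^{\ge 2}V$; and $f$ is a quasi-isomorphism of commutative differential graded algebras to the algebra $A_{PL}(X)$ of polynomial differential forms on the singular simplicial set of $X$. (The existence of such a model forces $X$ to be non-empty and path connected.) For a rational vector space $W$ write $W^\sharp=\mathrm{Hom}_{\mathbb{Q}}(W,\mathbb{Q})$. Let $L_0$ be the fundamental Lie algebra of $\Lambda V$: its underlying vector space is $(V^1)^\sharp$ (up to a shift of degree), and its bracket is dual to the differential on $V^1$, i.e. $\langle v,[x,y]\rangle=\langle dv;x,y\rangle$ for $v\in V^1$, where $\langle ab;x,y\rangle=x(a)y(b)-x(b)y(a)$ for $a,b\in V^1$. Suppose that $\dim_{\mathbb{Q}}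 H^1(X;\mathbb{Q})=\infty$. Then: 1. $H_1(X;\mathbb{Q})$ and $L_0/[L_0,L_0]$ are not isomorphic, not even as abelian groups; 2. for every base point $x_0\in X$, $\bigl(\pi_1(X,x_0)/[\pi_1(X,x_0),\pi_1(X,x_0)]\bigr)\otimes_{\mathbb{Z}}\mathbb{Q}$ and $L_0/[L_0,L_0]$ are not isomorphic, not even as abelian groups; 3. there is a surjective linear map $L_0/[L_0,L_0]\to H^1(X;\mathbb{Q})^\sharp$; 4. $\dim H_1(X;\mathbb{Q})<\dim H^1(X;\mathbb{Q})^\sharp$ as cardinal numbers. -/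

import Mathlib

universe u v

open scoped TensorProduct DirectSum

noncomputable section

namespace RatModel

/-! ### Graded pieces of an algebra generated by elements with assigned degrees -/

section Words

variable {A : Type u} [Ring A] [Algebra ℚ A] {ι : Type v} (g : ι → A) (δ : ι → ℕ)

/-- The span of the words (products) in the generators `g x` whose letters have total degree `k`. -/
def wordSpan (k : ℕ) : Submodule ℚ A :=
  Submodule.span ℚ {a | ∃ l : List ι, (l.map δ).sum = k ∧ (l.map g).prod = a}

/-- The span of the words in the generators with at least `n` letters. -/
def lengthSpan (n : ℕ) : Submodule ℚ A :=
  Submodule.span ℚ {a | ∃ l : List ι, n ≤ l.length ∧ (l.map g).prod = a}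

theorem word_mem (l : List ι) : (l.map g).prod ∈ wordSpan g δ (l.map δ).sum :=
  Submodule.subset_span ⟨l, rfl, rfl⟩

theorem gen_mem (x : ι) : g x ∈ wordSpan g δ (δ x) := by
  simpa using word_mem g δ [x]

theorem wordSpan_gradedMonoid : SetLike.GradedMonoid (wordSpan g δ) where
  one_mem := by simpa using word_mem g δ []
  mul_mem := by
    intro i j a b ha hb
    induction ha, hb using Submodule.span_induction₂ with
    | mem_mem x y hx hy =>
      obtain ⟨l, rfl, rfl⟩ := hx
      obtain ⟨m, rfl, rfl⟩ := hy
      simpa using word_mem g δ (l ++ m)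
    | zero_left y hy => simp
    | zero_right x hx => simp
    | add_left x y z _ _ _ h1 h2 => rw [add_mul]; exact add_mem h1 h2
    | add_right x y z _ _ _ h1 h2 => rw [mul_add]; exact add_mem h1 h2
    | smul_left r x y _ _ h => rw [smul_mul_assoc]; exact Submodule.smul_mem _ _ h
    | smul_right r x y _ _ h => rw [mul_smul_comm]; exact Submodule.smul_mem _ _ h

/-- Graded commutativity of generators implies graded commutativity. -/
theorem wordSpan_comm
    (h : ∀ x y, g x * g y = (-1 : ℚ) ^ (δ x * δ y) • (g y * g x)) {i j : ℕ} {a b : A}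
    (ha : a ∈ wordSpan g δ i) (hb : b ∈ wordSpan g δ j) :
    a * b = (-1 : ℚ) ^ (i * j) • (b * a) := by
  have h1 : ∀ (x : ι) (l : List ι),
      g x * (l.map g).prod = (-1 : ℚ) ^ (δ x * (l.map δ).sum) • ((l.map g).prod * g x) := by
    intro x l
    induction l with
    | nil => simp
    | cons y l ih =>
      simp only [List.map_cons, List.prod_cons, List.sum_cons]
      rw [← mul_assoc, h, smul_mul_assoc, mul_assoc, ih, mul_smul_comm, smul_smul, mul_add, pow_add,
        mul_assoc]
  have h2 : ∀ (m l : List ι),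
      (m.map g).prod * (l.map g).prod =
        (-1 : ℚ) ^ ((m.map δ).sum * (l.map δ).sum) • ((l.map g).prod * (m.map g).prod) := by
    intro m l
    induction m with
    | nil => simp
    | cons y m ih =>
      simp only [List.map_cons, List.prod_cons, List.sum_cons]
      rw [mul_assoc, ih, mul_smul_comm, ← mul_assoc, h1, smul_mul_assoc, smul_smul, add_mul, pow_add,
        mul_assoc, mul_comm ((-1 : ℚ) ^ _)]
  induction ha, hb using Submodule.span_induction₂ with
  | mem_mem x y hx hy =>
    obtain ⟨l, rfl, rfl⟩ := hx
    obtain ⟨m, rfl, rfl⟩ := hy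
    exact h2 l m
  | zero_left y hy => simp
  | zero_right x hx => simp
  | add_left x y z _ _ _ h1 h2 => rw [add_mul, mul_add, h1, h2, smul_add]
  | add_right x y z _ _ _ h1 h2 => rw [add_mul, mul_add, h1, h2, smul_add]
  | smul_left r x y _ _ h => rw [smul_mul_assoc, mul_smul_comm, h, smul_comm]
  | smul_right r x y _ _ h => rw [smul_mul_assoc, mul_smul_comm, h, smul_comm]

variable {g δ}

theorem degMap_eq {T : A →ₐ[ℚ] Polynomial A}
    (hT : ∀ x, T (g x) = Polynomial.monomial (δ x) (g x)) {k : ℕ} {a : A}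
    (ha : a ∈ wordSpan g δ k) : T a = Polynomial.monomial k a := by
  induction ha using Submodule.span_induction with
  | mem a h =>
    obtain ⟨l, rfl, rfl⟩ := h
    induction l with
    | nil => simp [Polynomial.monomial_zero_left]
    | cons x l ih =>
      simp only [List.map_cons, List.prod_cons, List.sum_cons]
      rw [map_mul, ih, hT, Polynomial.monomial_mul_monomial]
  | zero => simp
  | add x y _ _ h1 h2 => simp [h1, h2]
  | smul r x _ h => rw [map_smul, h, Polynomial.smul_monomial]

theorem wordSpan_isInternal {T : A →ₐ[ℚ] Polynomial A}
    (hT : ∀ x, T (g x) = Polynomial.monomial (δ x) (g x))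
    (hg : Algebra.adjoin ℚ (Set.range g) = ⊤) : DirectSum.IsInternal (wordSpan g δ) := by
  have := wordSpan_gradedMonoid g δ
  constructor
  · rw [injective_iff_map_eq_zero]
    intro x hx
    have key : ∀ y : (⨁ i, wordSpan g δ i), ∀ k,
        (T (DirectSum.coeAddMonoidHom (wordSpan g δ) y)).coeff k = (y k : A) := by
      intro y k
      induction y using DirectSum.induction_on with
      | zero => simp
      | of i a =>
        rw [DirectSum.coeAddMonoidHom_of, degMap_eq hT a.2, Polynomial.coeff_monomial,
          DirectSum.coe_of_apply]
        split_ifs <;> simp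
      | add x y hx hy => simp [hx, hy]
    ext k
    rw [← key x k, hx]
    simp
  · intro a
    have : a ∈ (DirectSum.coeAlgHom (wordSpan g δ)).range := by
      have h1 : Algebra.adjoin ℚ (Set.range g) ≤ (DirectSum.coeAlgHom (wordSpan g δ)).range := by
        rw [Algebra.adjoin_le_iff]
        rintro _ ⟨x, rfl⟩
        exact ⟨DirectSum.of (fun i => wordSpan g δ i) (δ x) ⟨g x, gen_mem g δ x⟩, by simp⟩
      exact h1 (hg ▸ Algebra.mem_top)
    exact this

end Words

/-! ### Commutative differential graded algebras over `ℚ` -/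

/-- A commutative cochain algebra over `ℚ` (CDGA): `A = ⨁_{k ≥ 0} A^k`, with
`a b = (-1)^{|a||b|} b a` and a differential of degree `+1` which is a derivation. -/
structure CDGA where
  carrier : Type u
  [ring : Ring carrier]
  [algebra : Algebra ℚ carrier]
  deg : ℕ → Submodule ℚ carrier
  gradedMonoid : SetLike.GradedMonoid deg
  internal : DirectSum.IsInternal deg
  comm : ∀ {i j : ℕ} {a b : carrier}, a ∈ deg i → b ∈ deg j →
    a * b = (-1 : ℚ) ^ (i * j) • (b * a)
  d : carrier →ₗ[ℚ] carrier
  d_mem : ∀ {i : ℕ} {a : carrier}, a ∈ deg i → d a ∈ deg (i + 1)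
  d_d : ∀ a, d (d a) = 0
  leibniz : ∀ {i : ℕ} {a : carrier} (b : carrier), a ∈ deg i →
    d (a * b) = d a * b + (-1 : ℚ) ^ i • (a * d b)

attribute [instance] CDGA.ring CDGA.algebra

namespace CDGA

/-- The cocycles of degree `k`. -/
def cocycles (A : CDGA.{u}) (k : ℕ) : Submodule ℚ A.carrier :=
  A.deg k ⊓ LinearMap.ker A.d

/-- The cohomology `H^k(A)`: cocycles of degree `k` modulo coboundaries. -/
abbrev H (A : CDGA.{u}) (k : ℕ) : Type u :=
  A.cocycles k ⧸ (LinearMap.range A.d).submoduleOf (A.cocycles k)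

/-- Morphisms of CDGAs. -/
structure Hom (A : CDGA.{u}) (B : CDGA.{v}) where
  toAlgHom : A.carrier →ₐ[ℚ] B.carrier
  map_deg : ∀ {k : ℕ} {a : A.carrier}, a ∈ A.deg k → toAlgHom a ∈ B.deg k
  map_d : ∀ a, toAlgHom (A.d a) = B.d (toAlgHom a)

namespace Hom

variable {A : CDGA.{u}} {B : CDGA.{v}} (f : Hom A B)

/-- The map induced on cocycles. -/
def cocyclesMap (k : ℕ) : A.cocycles k →ₗ[ℚ] B.cocycles k :=
  f.toAlgHom.toLinearMap.restrict (p := A.cocycles k) (q := B.cocycles k) fun a ha =>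
    ⟨f.map_deg ha.1, by
      have h : A.d a = 0 := ha.2
      change B.d (f.toAlgHom a) = 0
      rw [← f.map_d, h, map_zero]⟩

/-- The map induced on cohomology. -/
def HMap (k : ℕ) : A.H k →ₗ[ℚ] B.H k :=
  Submodule.mapQ _ _ (f.cocyclesMap k) (by
    rintro ⟨a, ha⟩ ⟨b, hb⟩
    exact ⟨f.toAlgHom b, by
      rw [← f.map_d, hb]
      rfl⟩)

/-- Quasi-isomorphisms: morphisms inducing isomorphisms in cohomology in every degree. -/
def IsQuasiIso : Prop := ∀ k, Function.Bijective (f.HMap k)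

end Hom

end CDGA

/-! ### Polynomial differential forms -/

/-- The generators of `(A_PL)_n`: `Sum.inl i` is `t_i` and `Sum.inr i` is `dt_i`. -/
abbrev PLGen (n : ℕ) : Type := Fin (n + 1) ⊕ Fin (n + 1)

/-- The degrees of the generators: `|t_i| = 0` and `|dt_i| = 1`. -/
def PLGen.deg {n : ℕ} : PLGen n → ℕ := Sum.elim (fun _ => 0) (fun _ => 1)

/-- The relations of `(A_PL)_n`: graded commutativity, `∑ t_i = 1` and `∑ dt_i = 0`. -/
inductive PLRel (n : ℕ) : FreeAlgebra ℚ (PLGen n) → FreeAlgebra ℚ (PLGen n) → Prop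
  | comm (x y : PLGen n) :
      PLRel n (FreeAlgebra.ι ℚ x * FreeAlgebra.ι ℚ y)
        ((-1 : ℚ) ^ (x.deg * y.deg) • (FreeAlgebra.ι ℚ y * FreeAlgebra.ι ℚ x))
  | sum_t : PLRel n (∑ i, FreeAlgebra.ι ℚ (Sum.inl i)) 1
  | sum_dt : PLRel n (∑ i, FreeAlgebra.ι ℚ (Sum.inr i)) 0

/-- The underlying algebra of `(A_PL)_n`: the free graded commutative algebra on `t_0, …, t_n` in
degree `0` and `dt_0, …, dt_n` in degree `1`, modulo `∑ t_i = 1` and `∑ dt_i = 0`. -/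
def PLForms (n : ℕ) : Type := RingQuot (PLRel n)

instance (n : ℕ) : Ring (PLForms n) := inferInstanceAs (Ring (RingQuot (PLRel n)))

instance (n : ℕ) : Algebra ℚ (PLForms n) := inferInstanceAs (Algebra ℚ (RingQuot (PLRel n)))

namespace PLForms

variable {n : ℕ}

/-- The quotient map from the free algebra. -/
def mk (n : ℕ) : FreeAlgebra ℚ (PLGen n) →ₐ[ℚ] PLForms n := RingQuot.mkAlgHom ℚ (PLRel n)

theorem mk_rel {a b : FreeAlgebra ℚ (PLGen n)} (h : PLRel n a b) : mk n a = mk n b :=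
  RingQuot.mkAlgHom_rel ℚ h

/-- The generators, as elements of `(A_PL)_n`. -/
def gen (x : PLGen n) : PLForms n := mk n (FreeAlgebra.ι ℚ x)

/-- The form `t_i`. -/
def t (i : Fin (n + 1)) : PLForms n := gen (Sum.inl i)

/-- The form `dt_i`. -/
def dt (i : Fin (n + 1)) : PLForms n := gen (Sum.inr i)

@[simp] theorem gen_inl (i : Fin (n + 1)) : gen (Sum.inl i) = t i := rfl

@[simp] theorem gen_inr (i : Fin (n + 1)) : gen (Sum.inr i) = dt i := rfl

theorem gen_comm (x y : PLGen n) :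
    gen x * gen y = (-1 : ℚ) ^ (x.deg * y.deg) • (gen y * gen x) := by
  simpa [gen] using mk_rel (PLRel.comm x y)

theorem sum_t : ∑ i : Fin (n + 1), t i = 1 := by
  simpa [gen, t] using mk_rel (PLRel.sum_t (n := n))

theorem sum_dt : ∑ i : Fin (n + 1), dt i = 0 := by
  simpa [gen, dt] using mk_rel (PLRel.sum_dt (n := n))

/-- The universal property of `(A_PL)_n` as an algebra. -/
def lift {B : Type u} [Ring B] [Algebra ℚ B] (φ : PLGen n → B)
    (hc : ∀ x y, φ x * φ y = (-1 : ℚ) ^ (x.deg * y.deg) • (φ y * φ x))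
    (ht : ∑ i, φ (Sum.inl i) = 1) (hdt : ∑ i, φ (Sum.inr i) = 0) : PLForms n →ₐ[ℚ] B :=
  RingQuot.liftAlgHom ℚ ⟨FreeAlgebra.lift ℚ φ, by
    intro a b h
    cases h with
    | comm x y => simpa using hc x y
    | sum_t => simpa using ht
    | sum_dt => simpa using hdt⟩

@[simp] theorem lift_gen {B : Type u} [Ring B] [Algebra ℚ B] (φ : PLGen n → B) (hc ht hdt)
    (x : PLGen n) : lift φ hc ht hdt (gen x) = φ x := by
  refine (RingQuot.liftAlgHom_mkAlgHom_apply ℚ (FreeAlgebra.lift ℚ φ) _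
    (FreeAlgebra.ι ℚ x)).trans ?_
  simp

@[simp] theorem lift_t {B : Type u} [Ring B] [Algebra ℚ B] (φ : PLGen n → B) (hc ht hdt)
    (i : Fin (n + 1)) : lift φ hc ht hdt (t i) = φ (Sum.inl i) :=
  lift_gen φ hc ht hdt (Sum.inl i)

@[simp] theorem lift_dt {B : Type u} [Ring B] [Algebra ℚ B] (φ : PLGen n → B) (hc ht hdt)
    (i : Fin (n + 1)) : lift φ hc ht hdt (dt i) = φ (Sum.inr i) :=
  lift_gen φ hc ht hdt (Sum.inr i)

theorem adjoin_gen : Algebra.adjoin ℚ (Set.range (gen (n := n))) = ⊤ := by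
  have h : Set.range (gen (n := n)) =
      (mk n) '' Set.range (FreeAlgebra.ι ℚ) := by
    rw [← Set.range_comp]; rfl
  rw [h, ← AlgHom.map_adjoin, FreeAlgebra.adjoin_range_ι, Algebra.map_top,
    AlgHom.range_eq_top]
  exact RingQuot.mkAlgHom_surjective ℚ _

/-- The forms of degree `k`. -/
def deg (n k : ℕ) : Submodule ℚ (PLForms n) := wordSpan gen PLGen.deg k

instance gradedMonoid (n : ℕ) : SetLike.GradedMonoid (deg n) :=
  wordSpan_gradedMonoid gen PLGen.deg

theorem gen_mem_deg (x : PLGen n) : gen x ∈ deg n x.deg := gen_mem gen PLGen.deg x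

theorem list_mem_deg (l : List (PLGen n)) : (l.map gen).prod ∈ deg n (l.map PLGen.deg).sum :=
  word_mem gen PLGen.deg l

/-- The homomorphism `a ↦ a X^k` for `a` of degree `k`. -/
def degMap (n : ℕ) : PLForms n →ₐ[ℚ] Polynomial (PLForms n) :=
  lift (fun x => Polynomial.monomial x.deg (gen x))
    (fun x y => by
      rw [Polynomial.monomial_mul_monomial, Polynomial.monomial_mul_monomial, gen_comm,
        Polynomial.smul_monomial, add_comm])
    (by
      have h := congrArg (Polynomial.monomial 0) (sum_t (n := n))
      rw [map_sum] at h
      simpa [PLGen.deg] using h)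
    (by
      have h := congrArg (Polynomial.monomial 1) (sum_dt (n := n))
      rw [map_sum] at h
      simpa [PLGen.deg] using h)

theorem isInternal (n : ℕ) : DirectSum.IsInternal (deg n) :=
  wordSpan_isInternal (T := degMap n) (fun x => by simp [degMap]) adjoin_gen

/-- The homomorphism `a ↦ !![(-1)^|a| a, d a; 0, a]`, which encodes the differential. -/
def dMatrix (n : ℕ) : PLForms n →ₐ[ℚ] Matrix (Fin 2) (Fin 2) (PLForms n) :=
  lift (Sum.elim (fun i => !![t i, dt i; 0, t i]) (fun i => !![-dt i, 0; 0, dt i]))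
    (by
      have h1 : ∀ i j : Fin (n + 1), t i * t j = t j * t i := fun i j => by
        simpa [PLGen.deg] using gen_comm (Sum.inl i) (Sum.inl j)
      have h2 : ∀ i j : Fin (n + 1), t i * dt j = dt j * t i := fun i j => by
        simpa [PLGen.deg] using gen_comm (Sum.inl i) (Sum.inr j)
      have h3 : ∀ i j : Fin (n + 1), dt i * dt j = -(dt j * dt i) := fun i j => by
        simpa [PLGen.deg] using gen_comm (Sum.inr i) (Sum.inr j)
      rintro (i | i) (j | j)
      · ext a b
        fin_cases a <;> fin_cases b <;>
          simp [PLGen.deg, h1 i j, h2 i j, h2 j i, add_comm]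
      · ext a b
        fin_cases a <;> fin_cases b <;> simp [PLGen.deg, h2 i j, h3 i j]
      · ext a b
        fin_cases a <;> fin_cases b <;> simp [PLGen.deg, h2 j i, h3 i j]
      · ext a b
        fin_cases a <;> fin_cases b <;> simp [PLGen.deg, h3 i j])
    (by
      have h1 := sum_t (n := n)
      have h2 := sum_dt (n := n)
      ext a b
      fin_cases a <;> fin_cases b <;> simp [Matrix.sum_apply, h1, h2])
    (by
      have h2 := sum_dt (n := n)
      ext a b
      fin_cases a <;> fin_cases b <;> simp [Matrix.sum_apply, h2])

/-- The differential of `(A_PL)_n`: the derivation of degree `1` with `d t_i = dt_i` and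
`d dt_i = 0`. -/
def d (n : ℕ) : PLForms n →ₗ[ℚ] PLForms n where
  toFun a := dMatrix n a 0 1
  map_add' a b := by simp
  map_smul' r a := by simp

@[simp] theorem d_t (i : Fin (n + 1)) : d n (t i) = dt i := by simp [d, dMatrix]

@[simp] theorem d_dt (i : Fin (n + 1)) : d n (dt i) = 0 := by simp [d, dMatrix]

theorem induction {p : PLForms n → Prop} (h0 : ∀ r : ℚ, p (algebraMap ℚ _ r))
    (ht : ∀ x, p (gen x)) (ha : ∀ a b, p a → p b → p (a + b)) (hm : ∀ a b, p a → p b → p (a * b))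
    (a : PLForms n) : p a := by
  have : a ∈ Algebra.adjoin ℚ (Set.range (gen (n := n))) := adjoin_gen ▸ Algebra.mem_top
  induction this using Algebra.adjoin_induction with
  | mem x hx => obtain ⟨y, rfl⟩ := hx; exact ht y
  | algebraMap r => exact h0 r
  | add x y _ _ h1 h2 => exact ha _ _ h1 h2
  | mul x y _ _ h1 h2 => exact hm _ _ h1 h2

theorem dMatrix_lower (a : PLForms n) : dMatrix n a 1 0 = 0 ∧ dMatrix n a 1 1 = a := by
  induction a using induction with
  | h0 r => simp [Matrix.algebraMap_eq_diagonal]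
  | ht x => rcases x with i | i <;> simp [dMatrix]
  | ha a b h1 h2 => simp [h1, h2]
  | hm a b h1 h2 => simp [Matrix.mul_apply, Fin.sum_univ_two, h1, h2]

theorem d_mul' (a b : PLForms n) : d n (a * b) = d n a * b + dMatrix n a 0 0 * d n b := by
  simp [d, Matrix.mul_apply, Fin.sum_univ_two, dMatrix_lower, add_comm]

theorem dMatrix_mul (a b : PLForms n) :
    dMatrix n (a * b) 0 0 = dMatrix n a 0 0 * dMatrix n b 0 0 := by
  simp [Matrix.mul_apply, Fin.sum_univ_two, dMatrix_lower]

theorem d_algebraMap (r : ℚ) : d n (algebraMap ℚ _ r) = 0 := by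
  simp [d, Matrix.algebraMap_eq_diagonal]

theorem dMatrix_gen (x : PLGen n) : dMatrix n (gen x) 0 0 = (-1 : ℚ) ^ x.deg • gen x := by
  rcases x with i | i <;> simp [dMatrix, PLGen.deg]

theorem dMatrix_deg {k : ℕ} {a : PLForms n} (ha : a ∈ deg n k) :
    dMatrix n a 0 0 = (-1 : ℚ) ^ k • a := by
  induction ha using Submodule.span_induction with
  | mem a h =>
    obtain ⟨l, rfl, rfl⟩ := h
    induction l with
    | nil => simp
    | cons x l ih =>
      simp only [List.map_cons, List.prod_cons, List.sum_cons]
      rw [dMatrix_mul, ih, dMatrix_gen, smul_mul_smul_comm, pow_add]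
  | zero => simp
  | add x y _ _ h1 h2 => simp [h1, h2]
  | smul r x _ h => simp [h, smul_comm r]

theorem leibniz {k : ℕ} {a : PLForms n} (b : PLForms n) (ha : a ∈ deg n k) :
    d n (a * b) = d n a * b + (-1 : ℚ) ^ k • (a * d n b) := by
  rw [d_mul', dMatrix_deg ha, smul_mul_assoc]

theorem d_gen_mem (x : PLGen n) : d n (gen x) ∈ deg n (x.deg + 1) := by
  rcases x with i | i
  · simpa [PLGen.deg] using gen_mem_deg (Sum.inr i : PLGen n)
  · simp

theorem d_mem {k : ℕ} {a : PLForms n} (ha : a ∈ deg n k) : d n a ∈ deg n (k + 1) := by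
  induction ha using Submodule.span_induction with
  | mem a h =>
    obtain ⟨l, rfl, rfl⟩ := h
    induction l with
    | nil =>
      have := d_algebraMap (n := n) 1
      rw [map_one] at this
      simp [this]
    | cons x l ih =>
      simp only [List.map_cons, List.prod_cons, List.sum_cons]
      rw [leibniz _ (gen_mem_deg x)]
      refine add_mem ?_ (Submodule.smul_mem _ _ ?_)
      · have := SetLike.mul_mem_graded (d_gen_mem x) (list_mem_deg l)
        rwa [add_right_comm] at this
      · have := SetLike.mul_mem_graded (gen_mem_deg x) ih
        rwa [← add_assoc] at this
  | zero => simp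
  | add x y _ _ h1 h2 => rw [map_add]; exact add_mem h1 h2
  | smul r x _ h => rw [map_smul]; exact Submodule.smul_mem _ _ h

theorem d_d (a : PLForms n) : d n (d n a) = 0 := by
  have hs : ∀ l : List (PLGen n), d n (d n (l.map gen).prod) = 0 := by
    intro l
    induction l with
    | nil =>
      have := d_algebraMap (n := n) 1
      rw [map_one] at this
      simp [this]
    | cons x l ih =>
      simp only [List.map_cons, List.prod_cons]
      have hx : d n (d n (gen x)) = 0 := by rcases x with i | i <;> simp
      rw [leibniz _ (gen_mem_deg x), map_add, map_smul,
        leibniz _ (gen_mem_deg x), leibniz _ (d_gen_mem x), ih, hx]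
      simp [pow_succ]
  obtain ⟨y, rfl⟩ := (isInternal n).2 a
  induction y using DirectSum.induction_on with
  | zero => simp
  | of i a =>
    rw [DirectSum.coeAddMonoidHom_of]
    obtain ⟨a, ha⟩ := a
    change d n (d n a) = 0
    induction ha using Submodule.span_induction with
    | mem a h => obtain ⟨l, rfl, rfl⟩ := h; exact hs l
    | zero => simp
    | add x y _ _ h1 h2 => rw [map_add, map_add, h1, h2, add_zero]
    | smul r x _ h => rw [map_smul, map_smul, h, smul_zero]
  | add x y h1 h2 => rw [map_add, map_add, map_add, h1, h2, add_zero]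

/-- The map `θ^* : (A_PL)_n → (A_PL)_m` of a map of vertices `θ`, with `t_k ↦ ∑_{θ j = k} t_j` and
`dt_k ↦ ∑_{θ j = k} dt_j`. -/
def pull {m n : ℕ} (θ : Fin (m + 1) → Fin (n + 1)) : PLForms n →ₐ[ℚ] PLForms m :=
  lift (Sum.elim (fun k => ∑ j with θ j = k, t j) (fun k => ∑ j with θ j = k, dt j))
    (by
      have hs : ∀ (x y : PLGen m) (r : ℚ), r = (-1 : ℚ) ^ (x.deg * y.deg) →
          gen x * gen y = r • (gen y * gen x) := fun x y r hr => hr ▸ gen_comm x y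
      rintro (i | i) (j | j) <;>
        simp only [Sum.elim_inl, Sum.elim_inr, Finset.sum_mul_sum, Finset.smul_sum] <;>
        rw [Finset.sum_comm] <;>
        refine Finset.sum_congr rfl fun a _ => Finset.sum_congr rfl fun b _ => hs _ _ _ rfl)
    (by
      simp only [Sum.elim_inl]
      rw [← sum_t, Finset.sum_fiberwise])
    (by
      simp only [Sum.elim_inr]
      rw [← sum_dt, Finset.sum_fiberwise])

theorem pull_mem {m n k : ℕ} (θ : Fin (m + 1) → Fin (n + 1)) {a : PLForms n} (ha : a ∈ deg n k) :
    pull θ a ∈ deg m k := by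
  have hg : ∀ x : PLGen n, pull θ (gen x) ∈ deg m x.deg := by
    rintro (i | i)
    · simp only [pull, lift_gen, Sum.elim_inl]
      exact Submodule.sum_mem _ fun j _ => gen_mem_deg (Sum.inl j : PLGen m)
    · simp only [pull, lift_gen, Sum.elim_inr]
      exact Submodule.sum_mem _ fun j _ => gen_mem_deg (Sum.inr j : PLGen m)
  induction ha using Submodule.span_induction with
  | mem a h =>
    obtain ⟨l, rfl, rfl⟩ := h
    induction l with
    | nil => simpa using list_mem_deg (n := m) []
    | cons x l ih =>
      simp only [List.map_cons, List.prod_cons, List.sum_cons, map_mul]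
      exact SetLike.mul_mem_graded (hg x) ih
  | zero => simp
  | add x y _ _ h1 h2 => rw [map_add]; exact add_mem h1 h2
  | smul r x _ h => rw [map_smul]; exact Submodule.smul_mem _ _ h

theorem pull_d {m n : ℕ} (θ : Fin (m + 1) → Fin (n + 1)) (a : PLForms n) :
    pull θ (d n a) = d m (pull θ a) := by
  have h : dMatrix m (pull θ a) = (dMatrix n a).map (pull θ) := by
    induction a using induction with
    | h0 r =>
      ext i j
      fin_cases i <;> fin_cases j <;> simp [Matrix.algebraMap_eq_diagonal]
    | ht x =>
      rcases x with k | k <;> ext i j <;> fin_cases i <;> fin_cases j <;>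
        simp [pull, dMatrix, Matrix.sum_apply]
    | ha a b h1 h2 => rw [map_add, map_add, map_add, h1, h2, Matrix.map_add _ (map_add _)]
    | hm a b h1 h2 => rw [map_mul, map_mul, map_mul, h1, h2, Matrix.map_mul]
  exact (congrFun (congrFun h 0) 1).symm

end PLForms

/-- The CDGA `(A_PL)_n` of polynomial differential forms on the `n`-simplex. -/
def PL (n : ℕ) : CDGA.{0} where
  carrier := PLForms n
  deg := PLForms.deg n
  gradedMonoid := wordSpan_gradedMonoid _ _
  internal := PLForms.isInternal n
  comm := wordSpan_comm _ _ PLForms.gen_comm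
  d := PLForms.d n
  d_mem := PLForms.d_mem
  d_d := PLForms.d_d
  leibniz := PLForms.leibniz

/-! ### Polynomial forms on simplicial sets and spaces -/

namespace APL

open CategoryTheory

/-- All families assigning to each simplex `σ` of `K` of dimension `n` an element of `(A_PL)_n`. -/
abbrev Family (K : SSet.{u}) : Type u :=
  (n : SimplexCategoryᵒᵖ) → K.obj n → PLForms n.unop.len

variable (K : SSet.{u})

/-- `A_PL^k(K)`: the families `Φ` of forms of degree `k` on the simplices of `K` which are
compatible with all simplicial operators (equivalently, with faces and degeneracies). -/
def form (k : ℕ) : Submodule ℚ (Family K) where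
  carrier := {Φ | (∀ n σ, Φ n σ ∈ PLForms.deg n.unop.len k) ∧
    ∀ (m n : SimplexCategoryᵒᵖ) (θ : m ⟶ n) (σ : K.obj m),
      Φ n (K.map θ σ) = PLForms.pull (fun i => θ.unop.toOrderHom i) (Φ m σ)}
  zero_mem' := ⟨fun _ _ => zero_mem _, fun _ _ _ _ => by simp⟩
  add_mem' := fun ha hb => ⟨fun n σ => add_mem (ha.1 n σ) (hb.1 n σ), fun m n θ σ => by
    simp [ha.2 m n θ σ, hb.2 m n θ σ]⟩
  smul_mem' := fun r a ha => ⟨fun n σ => Submodule.smul_mem _ r (ha.1 n σ), fun m n θ σ => by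
    simp [ha.2 m n θ σ]⟩

instance form_gradedMonoid : SetLike.GradedMonoid (form K) where
  one_mem := ⟨fun _ _ => SetLike.GradedOne.one_mem, fun _ _ _ _ => by simp⟩
  mul_mem := fun _ _ _ _ ha hb =>
    ⟨fun n σ => SetLike.mul_mem_graded (ha.1 n σ) (hb.1 n σ), fun m n θ σ => by
      simp [ha.2 m n θ σ, hb.2 m n θ σ]⟩

/-- The algebra `A_PL(K) = ⨁_k A_PL^k(K)`: finite sums of homogeneous compatible families. -/
def total : Subalgebra ℚ (Family K) := (DirectSum.coeAlgHom (form K)).range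

theorem form_le_total {k : ℕ} {Φ : Family K} (h : Φ ∈ form K k) : Φ ∈ total K :=
  ⟨DirectSum.of (fun i => form K i) k ⟨Φ, h⟩, by simp⟩

theorem total_induction {p : Family K → Prop} (h0 : p 0)
    (hf : ∀ k, ∀ Φ ∈ form K k, p Φ) (ha : ∀ Φ Ψ, p Φ → p Ψ → p (Φ + Ψ)) {Φ : Family K}
    (h : Φ ∈ total K) : p Φ := by
  obtain ⟨y, rfl⟩ := h
  induction y using DirectSum.induction_on with
  | zero => simpa using h0
  | of i a => simpa using hf i a a.2
  | add x y h1 h2 =>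
    have := ha _ _ h1 h2
    simpa using this

/-- The differential on families: `(dΦ)_σ = d(Φ_σ)`. -/
def dFamily : Family K →ₗ[ℚ] Family K where
  toFun Φ n σ := PLForms.d n.unop.len (Φ n σ)
  map_add' _ _ := by ext; simp
  map_smul' _ _ := by ext; simp

theorem dFamily_mem {k : ℕ} {Φ : Family K} (h : Φ ∈ form K k) : dFamily K Φ ∈ form K (k + 1) :=
  ⟨fun n σ => PLForms.d_mem (h.1 n σ), fun m n θ σ => by
    change PLForms.d _ (Φ n (K.map θ σ)) = PLForms.pull _ (PLForms.d _ (Φ m σ))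
    rw [PLForms.pull_d, h.2]⟩

theorem dFamily_total {Φ : Family K} (h : Φ ∈ total K) : dFamily K Φ ∈ total K := by
  refine total_induction K (p := fun Φ => dFamily K Φ ∈ total K) ?_ ?_ ?_ h
  · rw [map_zero]; exact zero_mem _
  · exact fun k Φ h => form_le_total K (dFamily_mem K h)
  · exact fun Φ Ψ h1 h2 => by rw [map_add]; exact add_mem h1 h2

/-- The degree `k` part of `A_PL(K)`. -/
def deg (k : ℕ) : Submodule ℚ (total K) := (form K k).comap (total K).val.toLinearMap

instance (k : ℕ) : AddCommGroup (form K k) := Submodule.addCommGroup _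

instance (k : ℕ) : AddCommGroup (deg K k) := Submodule.addCommGroup _

theorem deg_gradedMonoid : SetLike.GradedMonoid (deg K) where
  one_mem := (form_gradedMonoid K).one_mem
  mul_mem := fun _ _ _ _ ha hb => (form_gradedMonoid K).mul_mem ha hb

theorem deg_isInternal : DirectSum.IsInternal (deg K) := by
  have := deg_gradedMonoid K
  constructor
  · rw [injective_iff_map_eq_zero]
    intro x hx
    have key : ∀ (n : SimplexCategoryᵒᵖ) (σ : K.obj n) (y : ⨁ i, deg K i),
        ∃ z : ⨁ i, PLForms.deg n.unop.len i,
          (∀ k, (z k : PLForms n.unop.len) = ((y k : total K) : Family K) n σ) ∧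
          DirectSum.coeAddMonoidHom (PLForms.deg n.unop.len) z =
            ((DirectSum.coeAddMonoidHom (deg K) y : total K) : Family K) n σ := by
      intro n σ y
      induction y using DirectSum.induction_on with
      | zero => exact ⟨0, by simp, by
        rw [AddMonoidHom.map_zero, AddMonoidHom.map_zero]; rfl⟩
      | of i a =>
        refine ⟨DirectSum.of (fun i => PLForms.deg n.unop.len i) i
          ⟨((a : total K) : Family K) n σ, a.2.1 n σ⟩, ?_, by simp⟩
        intro k
        rw [DirectSum.coe_of_apply, DirectSum.coe_of_apply]
        split_ifs <;> simp
      | add x y h1 h2 =>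
        obtain ⟨z, hz, hz'⟩ := h1
        obtain ⟨w, hw, hw'⟩ := h2
        exact ⟨z + w, fun k => by simp [hz, hw], by simp [hz', hw']⟩
    refine DFinsupp.ext fun k => Subtype.ext <| Subtype.ext <| funext fun n => funext fun σ => ?_
    obtain ⟨z, hz, hz'⟩ := key n σ x
    have h0 : z = 0 := by
      apply (PLForms.isInternal n.unop.len).1
      rw [hz', hx, map_zero]
      rfl
    rw [← hz k, h0]
    rfl
  · rintro ⟨a, ha⟩
    obtain ⟨y, rfl⟩ := ha
    have : ∀ y : ⨁ i, form K i, ∃ z : ⨁ i, deg K i,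
        ((DirectSum.coeAddMonoidHom (deg K) z : total K) : Family K) =
          DirectSum.coeAlgHom (form K) y := by
      intro y
      induction y using DirectSum.induction_on with
      | zero => exact ⟨0, by rw [AddMonoidHom.map_zero, map_zero]; rfl⟩
      | of i a =>
        exact ⟨DirectSum.of (fun i => deg K i) i ⟨⟨a, form_le_total K a.2⟩, a.2⟩, by simp⟩
      | add x y h1 h2 =>
        obtain ⟨z, hz⟩ := h1
        obtain ⟨w, hw⟩ := h2
        exact ⟨z + w, by simp [hz, hw]⟩
    obtain ⟨z, hz⟩ := this y
    exact ⟨z, Subtype.ext hz⟩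

end APL

/-- The CDGA `A_PL(K)` of polynomial differential forms on a simplicial set `K`. -/
def APL (K : SSet.{u}) : CDGA.{u} where
  carrier := APL.total K
  deg := APL.deg K
  gradedMonoid := APL.deg_gradedMonoid K
  internal := APL.deg_isInternal K
  comm := fun {i j a b} ha hb => Subtype.ext <| by
    funext n σ
    exact (PL n.unop.len).comm (ha.1 n σ) (hb.1 n σ)
  d := LinearMap.restrict (p := Subalgebra.toSubmodule (APL.total K))
    (q := Subalgebra.toSubmodule (APL.total K)) (APL.dFamily K) fun _ h => APL.dFamily_total K h
  d_mem := fun ha => APL.dFamily_mem K ha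
  d_d := fun a => Subtype.ext <| by
    funext n σ
    exact (PL n.unop.len).d_d (a.1 n σ)
  leibniz := fun {i a} b ha => Subtype.ext <| by
    funext n σ
    exact (PL n.unop.len).leibniz _ (ha.1 n σ)

/-- `A_PL(X)`: polynomial differential forms on the singular simplicial set of `X`. -/
def APLSpace (X : Type u) [TopologicalSpace X] : CDGA.{u} := APL (TopCat.toSSet.obj (TopCat.of X))

/-! ### Free graded commutative algebras -/

section FreeGCA

variable (V : ℕ → Type u) [∀ i, AddCommGroup (V i)] [∀ i, Module ℚ (V i)]

/-- The relations `v w = (-1)^{ij} w v`, for `v ∈ V^i` and `w ∈ V^j`, in the tensor algebra of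
`⨁ V^i`. -/
inductive GCRel : TensorAlgebra ℚ (⨁ i, V i) → TensorAlgebra ℚ (⨁ i, V i) → Prop
  | comm (i j : ℕ) (v : V i) (w : V j) :
      GCRel (TensorAlgebra.ι ℚ (DirectSum.lof ℚ ℕ V i v) *
          TensorAlgebra.ι ℚ (DirectSum.lof ℚ ℕ V j w))
        ((-1 : ℚ) ^ (i * j) • (TensorAlgebra.ι ℚ (DirectSum.lof ℚ ℕ V j w) *
          TensorAlgebra.ι ℚ (DirectSum.lof ℚ ℕ V i v)))

/-- The free graded commutative algebra `ΛV` on a graded vector space `V = ⨁ V^i`. -/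
def FreeGCA : Type u := RingQuot (GCRel V)

instance : Ring (FreeGCA V) := inferInstanceAs (Ring (RingQuot (GCRel V)))

instance : Algebra ℚ (FreeGCA V) := inferInstanceAs (Algebra ℚ (RingQuot (GCRel V)))

namespace FreeGCA

/-- The quotient map from the tensor algebra. -/
def mk : TensorAlgebra ℚ (⨁ i, V i) →ₐ[ℚ] FreeGCA V := RingQuot.mkAlgHom ℚ (GCRel V)

/-- The inclusion `V^i → ΛV`. -/
def incl (i : ℕ) : V i →ₗ[ℚ] FreeGCA V :=
  (mk V).toLinearMap ∘ₗ TensorAlgebra.ι ℚ ∘ₗ DirectSum.lof ℚ ℕ V i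

/-- The homogeneous elements of `V`, as generators of `ΛV`. -/
def gen (x : Σ i, V i) : FreeGCA V := incl V x.1 x.2

/-- The degree `k` part of `ΛV`, spanned by the words `v_1 ⋯ v_r` with `∑ |v_i| = k`. -/
def deg (k : ℕ) : Submodule ℚ (FreeGCA V) := wordSpan (gen V) Sigma.fst k

/-- `Λ^{≥ n} V`, spanned by the words of length at least `n`. -/
def lengthGE (n : ℕ) : Submodule ℚ (FreeGCA V) := lengthSpan (gen V) n

variable {V}

/-- For a graded subspace `W ⊆ V`, the subalgebra `ΛW ⊆ ΛV`. -/
def sub (W : ∀ i, Submodule ℚ (V i)) : Subalgebra ℚ (FreeGCA V) :=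
  Algebra.adjoin ℚ {a | ∃ i, ∃ v ∈ W i, incl V i v = a}

theorem gen_comm (x y : Σ i, V i) :
    gen V x * gen V y = (-1 : ℚ) ^ (x.1 * y.1) • (gen V y * gen V x) := by
  have h : mk V _ = mk V _ := RingQuot.mkAlgHom_rel ℚ (GCRel.comm x.1 y.1 x.2 y.2)
  simpa [gen, incl] using h

/-- The universal property of `ΛV`. -/
def lift {B : Type v} [Ring B] [Algebra ℚ B] (φ : ∀ i, V i →ₗ[ℚ] B)
    (h : ∀ i j v w, φ i v * φ j w = (-1 : ℚ) ^ (i * j) • (φ j w * φ i v)) : FreeGCA V →ₐ[ℚ] B :=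
  RingQuot.liftAlgHom ℚ ⟨TensorAlgebra.lift ℚ (DirectSum.toModule ℚ ℕ B φ), by
    intro a b hab
    cases hab with
    | comm i j v w => simpa using h i j v w⟩

@[simp] theorem lift_incl {B : Type v} [Ring B] [Algebra ℚ B] (φ : ∀ i, V i →ₗ[ℚ] B) (h)
    (i : ℕ) (v : V i) : lift φ h (incl V i v) = φ i v := by
  refine (RingQuot.liftAlgHom_mkAlgHom_apply ℚ
    (TensorAlgebra.lift ℚ (DirectSum.toModule ℚ ℕ B φ)) _ _).trans ?_
  simp

theorem adjoin_gen : Algebra.adjoin ℚ (Set.range (gen V)) = ⊤ := by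
  have h1 : (⊤ : Subalgebra ℚ (FreeGCA V)) =
      (Algebra.adjoin ℚ (Set.range (TensorAlgebra.ι ℚ (M := ⨁ i, V i)))).map (mk V) := by
    rw [TensorAlgebra.adjoin_range_ι, Algebra.map_top, eq_comm, AlgHom.range_eq_top]
    exact RingQuot.mkAlgHom_surjective ℚ _
  rw [eq_top_iff, h1, AlgHom.map_adjoin, Algebra.adjoin_le_iff]
  rintro _ ⟨_, ⟨x, rfl⟩, rfl⟩
  induction x using DirectSum.induction_on with
  | zero => simp
  | of i v => exact Algebra.subset_adjoin ⟨⟨i, v⟩, rfl⟩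
  | add x y h1 h2 =>
    simp only [map_add]
    exact add_mem h1 h2

/-- The homomorphism `a ↦ a X^k` for `a` of degree `k`. -/
def degMap : FreeGCA V →ₐ[ℚ] Polynomial (FreeGCA V) :=
  lift (fun i => (Polynomial.monomial i).restrictScalars ℚ ∘ₗ incl V i) (by
    intro i j v w
    have h := gen_comm (V := V) ⟨i, v⟩ ⟨j, w⟩
    change Polynomial.monomial i (incl V i v) * Polynomial.monomial j (incl V j w) =
      (-1 : ℚ) ^ (i * j) • (Polynomial.monomial j (incl V j w) * Polynomial.monomial i (incl V i v))
    simp only [gen] at h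
    rw [Polynomial.monomial_mul_monomial, Polynomial.monomial_mul_monomial, h,
      Polynomial.smul_monomial, add_comm])

theorem degMap_gen (x : Σ i, V i) : degMap (gen V x) = Polynomial.monomial x.1 (gen V x) := by
  simp [degMap, gen]

theorem isInternal : DirectSum.IsInternal (deg V) :=
  wordSpan_isInternal degMap_gen adjoin_gen

end FreeGCA

end FreeGCA

/-! ### Minimal Sullivan algebras -/

/-- A minimal Sullivan algebra `(ΛV, d)`: `V` is a graded vector space of positive degree with a
filtration `0 = F 0 ⊆ F 1 ⊆ ⋯` by graded subspaces, exhausting `V`, such that `d` maps `F (k + 1)`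
to `Λ(F k)`; and `d V ⊆ Λ^{≥ 2} V`. -/
structure MinimalSullivanAlgebra where
  V : ℕ → Type u
  [addCommGroup : ∀ i, AddCommGroup (V i)]
  [module : ∀ i, Module ℚ (V i)]
  pos : Subsingleton (V 0)
  d : FreeGCA V →ₗ[ℚ] FreeGCA V
  d_mem : ∀ {i : ℕ} {a : FreeGCA V}, a ∈ FreeGCA.deg V i → d a ∈ FreeGCA.deg V (i + 1)
  d_d : ∀ a, d (d a) = 0
  leibniz : ∀ {i : ℕ} {a : FreeGCA V} (b : FreeGCA V), a ∈ FreeGCA.deg V i →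
    d (a * b) = d a * b + (-1 : ℚ) ^ i • (a * d b)
  filtration : ∃ F : ℕ → ∀ i, Submodule ℚ (V i),
    (∀ i, F 0 i = ⊥) ∧ (∀ k i, F k i ≤ F (k + 1) i) ∧ (∀ i (v : V i), ∃ k, v ∈ F k i) ∧
    ∀ k i, ∀ v ∈ F (k + 1) i, d (FreeGCA.incl V i v) ∈ FreeGCA.sub (F k)
  minimal : ∀ i (v : V i), d (FreeGCA.incl V i v) ∈ FreeGCA.lengthGE V 2

attribute [instance] MinimalSullivanAlgebra.addCommGroup MinimalSullivanAlgebra.module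

namespace MinimalSullivanAlgebra

variable (M : MinimalSullivanAlgebra.{u})

/-- The CDGA `(ΛV, d)`. -/
def toCDGA : CDGA.{u} where
  carrier := FreeGCA M.V
  deg := FreeGCA.deg M.V
  gradedMonoid := wordSpan_gradedMonoid _ _
  internal := FreeGCA.isInternal
  comm := wordSpan_comm _ _ FreeGCA.gen_comm
  d := M.d
  d_mem := M.d_mem
  d_d := M.d_d
  leibniz := M.leibniz

/-! ### The fundamental Lie algebra -/

/-- The projection `ΛV → ΛV^1` onto the exterior algebra of `V^1` that kills `V^i` for `i ≠ 1`. -/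
def proj : FreeGCA M.V →ₐ[ℚ] ExteriorAlgebra ℚ (M.V 1) :=
  FreeGCA.lift
    (fun i => ExteriorAlgebra.ι ℚ ∘ₗ DirectSum.component ℚ ℕ M.V 1 ∘ₗ DirectSum.lof ℚ ℕ M.V i) (by
    intro i j v w
    by_cases hi : i = 1
    · by_cases hj : j = 1
      · subst hi hj
        have := ExteriorAlgebra.ι_add_mul_swap (R := ℚ) v w
        simpa [DirectSum.component.lof_self] using eq_neg_of_add_eq_zero_left this
      · simp [DirectSum.component.of, hj]
    · simp [DirectSum.component.of, hi])

@[simp] theorem proj_incl_one (v : M.V 1) :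
    M.proj (FreeGCA.incl M.V 1 v) = ExteriorAlgebra.ι ℚ v := by
  simp [proj]

/-- The pairing `⟨ω; x, y⟩` of `ω ∈ ΛV` with `x, y ∈ (V^1)^♯`. It only involves the part of `ω` in
`Λ^2 V^1`, and `⟨v w; x, y⟩ = x(v) y(w) - x(w) y(v)` for `v, w ∈ V^1`. -/
def pairing (x y : Module.Dual ℚ (M.V 1)) : FreeGCA M.V →ₗ[ℚ] ℚ :=
  ExteriorAlgebra.algebraMapInv.toLinearMap ∘ₗ CliffordAlgebra.contractLeft y ∘ₗ
    CliffordAlgebra.contractLeft x ∘ₗ M.proj.toLinearMap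

theorem pairing_apply (x y : Module.Dual ℚ (M.V 1)) (a : FreeGCA M.V) :
    M.pairing x y a = ExteriorAlgebra.algebraMapInv
      (CliffordAlgebra.contractLeft y (CliffordAlgebra.contractLeft x (M.proj a))) := rfl

theorem contract_ι_mul (x : Module.Dual ℚ (M.V 1)) (v : M.V 1)
    (b : ExteriorAlgebra ℚ (M.V 1)) :
    CliffordAlgebra.contractLeft x (ExteriorAlgebra.ι ℚ v * b) =
      x v • b - ExteriorAlgebra.ι ℚ v * CliffordAlgebra.contractLeft x b :=
  CliffordAlgebra.contractLeft_ι_mul x v b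

theorem contract_ι (x : Module.Dual ℚ (M.V 1)) (v : M.V 1) :
    CliffordAlgebra.contractLeft x (ExteriorAlgebra.ι ℚ v) =
      algebraMap ℚ (ExteriorAlgebra ℚ (M.V 1)) (x v) :=
  CliffordAlgebra.contractLeft_ι _ x v

theorem contract_algebraMap (x : Module.Dual ℚ (M.V 1)) (r : ℚ) :
    CliffordAlgebra.contractLeft x (algebraMap ℚ (ExteriorAlgebra ℚ (M.V 1)) r) = 0 :=
  CliffordAlgebra.contractLeft_algebraMap _ x r

theorem inv_algebraMap (r : ℚ) :
    ExteriorAlgebra.algebraMapInv (algebraMap ℚ (ExteriorAlgebra ℚ (M.V 1)) r) = r := by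
  simp

theorem pairing_mul (x y : Module.Dual ℚ (M.V 1)) (v w : M.V 1) :
    M.pairing x y (FreeGCA.incl M.V 1 v * FreeGCA.incl M.V 1 w) = x v * y w - x w * y v := by
  rw [pairing_apply, map_mul M.proj, proj_incl_one, proj_incl_one]
  simp only [contract_ι_mul, contract_ι, map_sub, map_smul, inv_algebraMap,
    contract_algebraMap, mul_zero, sub_zero, smul_eq_mul]
  ring

/-- The span of the products `v w` with `v, w ∈ V^1`. -/
def quad : Submodule ℚ (FreeGCA M.V) :=
  Submodule.span ℚ {a | ∃ v w : M.V 1, FreeGCA.incl M.V 1 v * FreeGCA.incl M.V 1 w = a}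

theorem incl_mem (i : ℕ) (v : M.V i) : FreeGCA.incl M.V i v ∈ FreeGCA.deg M.V i :=
  gen_mem (FreeGCA.gen M.V) Sigma.fst ⟨i, v⟩

theorem word_two (l : List (Σ i, M.V i)) (h2 : 2 ≤ l.length)
    (hs : (l.map Sigma.fst).sum = 2) : (l.map (FreeGCA.gen M.V)).prod ∈ M.quad := by
  have := M.pos
  by_cases h0 : ∃ x ∈ l, x.1 = 0
  · obtain ⟨⟨i, v⟩, hx, rfl⟩ := h0
    have : (l.map (FreeGCA.gen M.V)).prod = 0 := by
      obtain ⟨s, t, rfl⟩ := List.append_of_mem hx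
      have hv : v = 0 := Subsingleton.elim _ _
      simp [FreeGCA.gen, hv]
    rw [this]
    exact zero_mem _
  · push Not at h0
    match l, h2, hs, h0 with
    | [⟨i, v⟩, ⟨j, w⟩], _, hs, h0 =>
      have hi := h0 ⟨i, v⟩ (by simp)
      have hj := h0 ⟨j, w⟩ (by simp)
      simp only [List.map_cons, List.map_nil, List.sum_cons, List.sum_nil] at hs hi hj
      obtain rfl : i = 1 := by omega
      obtain rfl : j = 1 := by omega
      exact Submodule.subset_span ⟨v, w, by simp [FreeGCA.gen]⟩
    | x :: y :: z :: l, _, hs, h0 =>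
      have hx := h0 x (by simp)
      have hy := h0 y (by simp)
      have hz := h0 z (by simp)
      simp only [List.map_cons, List.sum_cons] at hs
      omega

theorem d_mem_quad (v : M.V 1) : M.d (FreeGCA.incl M.V 1 v) ∈ M.quad := by
  have h1 : FreeGCA.degMap (M.d (FreeGCA.incl M.V 1 v)) =
      Polynomial.monomial 2 (M.d (FreeGCA.incl M.V 1 v)) :=
    degMap_eq FreeGCA.degMap_gen (M.d_mem (M.incl_mem 1 v))
  have h2 : ∀ a ∈ FreeGCA.lengthGE M.V 2, (FreeGCA.degMap a).coeff 2 ∈ M.quad := by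
    intro a ha
    induction ha using Submodule.span_induction with
    | mem a h =>
      obtain ⟨l, hl, rfl⟩ := h
      rw [degMap_eq FreeGCA.degMap_gen (word_mem (FreeGCA.gen M.V) Sigma.fst l),
        Polynomial.coeff_monomial]
      split_ifs with hs
      · exact M.word_two l hl hs
      · exact zero_mem _
    | zero => simp
    | add x y _ _ h1 h2 => rw [map_add, Polynomial.coeff_add]; exact add_mem h1 h2
    | smul r x _ h => rw [map_smul, Polynomial.coeff_smul]; exact Submodule.smul_mem _ _ h
  have h3 := h2 _ (M.minimal 1 v)
  rwa [h1, Polynomial.coeff_monomial, if_pos rfl] at h3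

/-- The bracket of `L_0`, dual to the quadratic part of the differential on `V^1`:
`⟨v, [x, y]⟩ = ⟨d v; x, y⟩` for `v ∈ V^1`. -/
def bracket (x y : Module.Dual ℚ (M.V 1)) : Module.Dual ℚ (M.V 1) :=
  M.pairing x y ∘ₗ M.d ∘ₗ FreeGCA.incl M.V 1

theorem bracket_apply (x y : Module.Dual ℚ (M.V 1)) (v : M.V 1) :
    M.bracket x y v = M.pairing x y (M.d (FreeGCA.incl M.V 1 v)) := rfl

theorem bracket_self (x : Module.Dual ℚ (M.V 1)) : M.bracket x x = 0 := by
  ext v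
  rw [bracket_apply, pairing_apply, CliffordAlgebra.contractLeft_contractLeft]
  simp

/-- The triple contraction. -/
def tri (x y z : Module.Dual ℚ (M.V 1)) : FreeGCA M.V →ₗ[ℚ] ℚ :=
  ExteriorAlgebra.algebraMapInv.toLinearMap ∘ₗ CliffordAlgebra.contractLeft z ∘ₗ
    CliffordAlgebra.contractLeft y ∘ₗ CliffordAlgebra.contractLeft x ∘ₗ M.proj.toLinearMap

theorem tri_apply (x y z : Module.Dual ℚ (M.V 1)) (a : FreeGCA M.V) :
    M.tri x y z a = ExteriorAlgebra.algebraMapInv (CliffordAlgebra.contractLeft z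
      (CliffordAlgebra.contractLeft y (CliffordAlgebra.contractLeft x (M.proj a)))) := rfl

theorem tri_word (x y z : Module.Dual ℚ (M.V 1)) (a b c : M.V 1) :
    M.tri x y z (FreeGCA.incl M.V 1 a * (FreeGCA.incl M.V 1 b * FreeGCA.incl M.V 1 c)) =
      x a * (y b * z c - y c * z b) - y a * (x b * z c - x c * z b)
        + z a * (x b * y c - x c * y b) := by
  rw [tri_apply, map_mul M.proj, map_mul M.proj, proj_incl_one, proj_incl_one, proj_incl_one]
  simp only [contract_ι_mul, contract_ι, map_sub, map_smul, inv_algebraMap,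
    contract_algebraMap, mul_zero, sub_zero, smul_eq_mul, smul_zero]
  ring

theorem tri_mul_left (x y z : Module.Dual ℚ (M.V 1)) (a : M.V 1) {q : FreeGCA M.V}
    (hq : q ∈ M.quad) : M.tri x y z (FreeGCA.incl M.V 1 a * q) =
      x a * M.pairing y z q - y a * M.pairing x z q + z a * M.pairing x y q := by
  induction hq using Submodule.span_induction with
  | mem q h =>
    obtain ⟨b, c, rfl⟩ := h
    simp only [tri_word, pairing_mul]
  | zero => simp
  | add p q _ _ h1 h2 => rw [mul_add, map_add, h1, h2]; simp only [map_add]; ring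
  | smul r p _ h => rw [mul_smul_comm, map_smul, h]; simp only [map_smul, smul_eq_mul]; ring

theorem tri_mul_right (x y z : Module.Dual ℚ (M.V 1)) (a : M.V 1) {q : FreeGCA M.V}
    (hq : q ∈ M.quad) : M.tri x y z (q * FreeGCA.incl M.V 1 a) =
      x a * M.pairing y z q - y a * M.pairing x z q + z a * M.pairing x y q := by
  induction hq using Submodule.span_induction with
  | mem q h =>
    obtain ⟨b, c, rfl⟩ := h
    rw [mul_assoc]
    simp only [tri_word, pairing_mul]
    ring
  | zero => simp
  | add p q _ _ h1 h2 => rw [add_mul, map_add, h1, h2]; simp only [map_add]; ring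
  | smul r p _ h => rw [smul_mul_assoc, map_smul, h]; simp only [map_smul, smul_eq_mul]; ring

theorem tri_d (x y z : Module.Dual ℚ (M.V 1)) {q : FreeGCA M.V} (hq : q ∈ M.quad) :
    M.tri x y z (M.d q) = M.pairing (M.bracket x y) z q - M.pairing (M.bracket x z) y q
      + M.pairing (M.bracket y z) x q := by
  induction hq using Submodule.span_induction with
  | mem q h =>
    obtain ⟨b, c, rfl⟩ := h
    rw [M.leibniz _ (M.incl_mem 1 b)]
    simp only [map_add, map_smul, pairing_mul, M.tri_mul_left _ _ _ _ (M.d_mem_quad _),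
      M.tri_mul_right _ _ _ _ (M.d_mem_quad _), bracket_apply, smul_eq_mul]
    ring
  | zero => simp
  | add p q _ _ h1 h2 => simp only [map_add, h1, h2]; ring
  | smul r p _ h => simp only [map_smul, h, smul_eq_mul]; ring

theorem bracket_jacobi (x y z : Module.Dual ℚ (M.V 1)) :
    M.bracket (M.bracket x y) z - M.bracket (M.bracket x z) y + M.bracket (M.bracket y z) x = 0 := by
  ext v
  have h := M.tri_d x y z (M.d_mem_quad v)
  rw [M.d_d, map_zero] at h
  exact h.symm

/-- The bracket as a bilinear map. -/
def bracketₗ : Module.Dual ℚ (M.V 1) →ₗ[ℚ] Module.Dual ℚ (M.V 1) →ₗ[ℚ] Module.Dual ℚ (M.V 1) :=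
  LinearMap.mk₂ ℚ M.bracket
    (fun x x' y => by ext v; simp [bracket_apply, pairing_apply])
    (fun r x y => by ext v; simp [bracket_apply, pairing_apply])
    (fun x y y' => by ext v; simp [bracket_apply, pairing_apply])
    (fun r x y => by ext v; simp [bracket_apply, pairing_apply])

theorem bracket_skew (x y : Module.Dual ℚ (M.V 1)) : M.bracket x y = -M.bracket y x := by
  have h := M.bracket_self (x + y)
  change M.bracketₗ (x + y) (x + y) = 0 at h
  have hx : M.bracketₗ x x = 0 := M.bracket_self x
  have hy : M.bracketₗ y y = 0 := M.bracket_self y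
  rw [map_add, map_add, LinearMap.add_apply, LinearMap.add_apply, hx, hy, zero_add, add_zero,
    add_comm] at h
  exact eq_neg_of_add_eq_zero_left h

/-- The fundamental Lie algebra `L_0` of `ΛV`. Its underlying vector space is `(V^1)^♯`; the degree
shift `s L_0 = (V^1)^♯` is left implicit. -/
def FundamentalLieAlgebra : Type u := Module.Dual ℚ (M.V 1)

instance : AddCommGroup M.FundamentalLieAlgebra :=
  inferInstanceAs (AddCommGroup (Module.Dual ℚ (M.V 1)))

instance : Module ℚ M.FundamentalLieAlgebra :=
  inferInstanceAs (Module ℚ (Module.Dual ℚ (M.V 1)))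

instance : LieRing M.FundamentalLieAlgebra where
  bracket x y := M.bracket x y
  add_lie x y z := LinearMap.map_add₂ M.bracketₗ x y z
  lie_add x y z := map_add (M.bracketₗ x) y z
  lie_self x := M.bracket_self x
  leibniz_lie x y z := by
    change M.bracket x (M.bracket y z) = M.bracket (M.bracket x y) z + M.bracket y (M.bracket x z)
    have h := M.bracket_jacobi x y z
    rw [M.bracket_skew x (M.bracket y z), M.bracket_skew y (M.bracket x z)]
    exact (eq_of_sub_eq_zero (by rw [← h]; abel)).symm

instance : LieAlgebra ℚ M.FundamentalLieAlgebra where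
  lie_smul r x y := map_smul (M.bracketₗ x) r y

/-- The abelianization `L_0 / [L_0, L_0]`. -/
abbrev LieAbelianization : Type u :=
  M.FundamentalLieAlgebra ⧸
    (⁅(⊤ : LieIdeal ℚ M.FundamentalLieAlgebra), (⊤ : LieIdeal ℚ M.FundamentalLieAlgebra)⁆)

end MinimalSullivanAlgebra

/-! ### Singular homology and cohomology with rational coefficients -/

section Singular

variable (X : Type u) [TopologicalSpace X]

/-- The singular chain complex `C_*(X; ℚ)`. -/
abbrev singularChains : ChainComplex (ModuleCat.{u} ℚ) ℕ :=
  ((AlgebraicTopology.singularChainComplexFunctor (ModuleCat.{u} ℚ)).obj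
    (ModuleCat.of ℚ (ULift.{u} ℚ))).obj (TopCat.of X)

/-- Singular homology `H_n(X; ℚ)`. -/
abbrev singularHomology (n : ℕ) : Type u :=
  ((AlgebraicTopology.singularHomologyFunctor (ModuleCat.{u} ℚ) n).obj
    (ModuleCat.of ℚ (ULift.{u} ℚ))).obj (TopCat.of X)

/-- Singular cocycles: the kernel of `Hom(C_n, ℚ) → Hom(C_{n+1}, ℚ)`. -/
def singularCocycles (n : ℕ) : Submodule ℚ (Module.Dual ℚ ((singularChains X).X n)) :=
  LinearMap.ker ((singularChains X).d (n + 1) n).hom.dualMap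

/-- Singular coboundaries: the image of `Hom(C_{n-1}, ℚ) → Hom(C_n, ℚ)`; this is zero for `n = 0`,
where the complex has no differential. -/
def singularCoboundaries (n : ℕ) : Submodule ℚ (Module.Dual ℚ ((singularChains X).X n)) :=
  LinearMap.range ((singularChains X).d n (n - 1)).hom.dualMap

/-- Singular cohomology `H^n(X; ℚ)`, the cohomology of the dual of the singular chain complex. -/
abbrev singularCohomology (n : ℕ) : Type u :=
  singularCocycles X n ⧸ (singularCoboundaries X n).submoduleOf (singularCocycles X n)

end Singular

end RatModel

end

/-! Write `H = H^1(X; ℚ)`. Since `H` is infinite-dimensional, `dim H < dim H^♯` (Erdős–Kaplansky).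
The abelianization of `L_0` is at least as large as `H^♯`, while `H_1(X; ℚ)` and `ℚ ⊗ π_1^{ab}` are
no larger than `H`.

Large side. Let `Z ⊆ V^1` be the kernel of `d` on `V^1`. A bracket evaluated at `v` is a contraction
of `dv`, so brackets restrict to zero on `Z`, and restriction induces a surjection from the
abelianization of `L_0` onto `Z^♯` (`exists_surjective_dual_closedGens`). As `V^0 = 0`, the
degree-one part of `ΛV` is `V^1`, so `Z` surjects onto `H^1(ΛV) ≅ H^1(A_PL(X))`
(`exists_surjective_closedGens`). With an injection `H → H^1(A_PL(X))` (`exists_injective_APL`) and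
a linear section, `H` embeds in `Z`, and dualizing gives `Z^♯ → H^♯` onto.

Small side. If `W^♯` embeds in `H`, then `dim W ≤ dim W^♯ ≤ dim H < dim H^♯`. This applies to `W =
H_1(X; ℚ)` (`exists_injective_dual_homology`) and to `W = ℚ ⊗ π_1^{ab}`
(`exists_injective_dual_fundamentalGroup`). An additive isomorphism of rational vector spaces is
linear, so `W` isomorphic to the abelianization of `L_0` would surject onto `H^♯`, a contradiction.

Only injections are needed, not the full de Rham, universal coefficient or Hurewicz isomorphisms. A
cocycle `c` becomes the form `∑ c(σ_{0j}) dt_j`; if that form is exact, integrating along edges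
shows that `c` is a coboundary. A functional on `π_1` becomes a cocycle by closing paths up to loops
in the fundamental groupoid; it is recovered from its values on loops, where coboundaries vanish. -/

noncomputable section

namespace RatModel

/-! ### Cochains on a simplicial set -/

section Cochains

open CategoryTheory Limits Simplicial Opposite

variable {K : SSet.{u}}

/-- The rational chain complex of a simplicial set. -/
abbrev chains (K : SSet.{u}) : ChainComplex (ModuleCat.{u} ℚ) ℕ :=
  K.chainComplex (ModuleCat.of ℚ (ULift.{u} ℚ))

/-- The simplex `σ` as a chain. -/
def simplexChain {n : ℕ} (σ : K _⦋n⦌) : (chains K).X n :=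
  (K.ιChainComplex (R := ModuleCat.of ℚ (ULift.{u} ℚ)) σ).hom (ULift.up 1)

theorem d_simplexChain {n : ℕ} (σ : K _⦋n + 1⦌) :
    ((chains K).d (n + 1) n).hom (simplexChain σ) =
      ∑ i : Fin (n + 2), (-1 : ℤ) ^ i.val • simplexChain (K.δ i σ) := by
  have h := congrArg (fun f => f.hom (ULift.up (1 : ℚ)))
    (K.ιChainComplex_d (ModuleCat.of ℚ (ULift.{u} ℚ)) σ)
  refine h.trans ?_
  simp only [ModuleCat.hom_sum, LinearMap.sum_apply, ModuleCat.hom_zsmul, LinearMap.smul_apply]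
  rfl

/-- The chain module is a coproduct of copies of `ℚ` indexed by simplices. Functionals are first
moved to the target `ULift ℚ`, so that they become morphisms of `ModuleCat.{u} ℚ`. -/
theorem dual_ext {n : ℕ} {f g : Module.Dual ℚ ((chains K).X n)}
    (h : ∀ σ : K _⦋n⦌, f (simplexChain σ) = g (simplexChain σ)) : f = g := by
  have key : ModuleCat.ofHom (ULift.moduleEquiv.{0, 0, u}.symm.toLinearMap ∘ₗ f) =
      ModuleCat.ofHom (ULift.moduleEquiv.{0, 0, u}.symm.toLinearMap ∘ₗ g) := by
    refine SSet.chainComplex_hom_ext (fun σ => ?_)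
    refine ModuleCat.hom_ext (LinearMap.ext fun x => ?_)
    have hx : x = x.down • (ULift.up 1 : ULift.{u} ℚ) := by ext; simp
    rw [hx, map_smul, map_smul]
    exact congrArg (fun y => x.down • (ULift.up y : ULift.{u} ℚ)) (h σ)
  exact LinearMap.ext fun x => congrArg (fun f => (f.hom x).down) key

/-- The cochain with given values on simplices. -/
def cochainFun {n : ℕ} (g : K _⦋n⦌ → ℚ) : Module.Dual ℚ ((chains K).X n) :=
  ULift.moduleEquiv.{0, 0, u}.toLinearMap ∘ₗ ((K.isColimitChainComplexXCofan _ n).desc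
    (Cofan.mk (ModuleCat.of ℚ (ULift.{u} ℚ)) fun σ => ModuleCat.ofHom (g σ • LinearMap.id))).hom

@[simp]
theorem cochainFun_simplexChain {n : ℕ} (g : K _⦋n⦌ → ℚ) (σ : K _⦋n⦌) :
    cochainFun g (simplexChain σ) = g σ := by
  have h := congrArg (fun f => f.hom (ULift.up (1 : ℚ)))
    ((K.isColimitChainComplexXCofan (ModuleCat.of ℚ (ULift.{u} ℚ)) n).fac
      (Cofan.mk (ModuleCat.of ℚ (ULift.{u} ℚ)) fun σ => ModuleCat.ofHom (g σ • LinearMap.id)) ⟨σ⟩)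
  refine (congrArg ULift.down h).trans ?_
  simp

/-- The cochain with given values on simplices, as a linear map. -/
def cochain (K : SSet.{u}) (n : ℕ) : (K _⦋n⦌ → ℚ) →ₗ[ℚ] Module.Dual ℚ ((chains K).X n) where
  toFun := cochainFun
  map_add' _ _ := dual_ext fun _ => by simp
  map_smul' _ _ := dual_ext fun _ => by simp

@[simp]
theorem cochain_simplexChain {n : ℕ} (g : K _⦋n⦌ → ℚ) (σ : K _⦋n⦌) :
    cochain K n g (simplexChain σ) = g σ := cochainFun_simplexChain g σ

theorem dual_d_two (c : Module.Dual ℚ ((chains K).X 1)) (σ : K _⦋2⦌) :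
    c (((chains K).d 2 1).hom (simplexChain σ)) =
      c (simplexChain (K.δ 0 σ)) - c (simplexChain (K.δ 1 σ)) + c (simplexChain (K.δ 2 σ)) := by
  refine (congrArg c (d_simplexChain σ)).trans ?_
  simp [Fin.sum_univ_three, sub_eq_add_neg]

theorem dual_d_one (b : Module.Dual ℚ ((chains K).X 0)) (σ : K _⦋1⦌) :
    b (((chains K).d 1 0).hom (simplexChain σ)) =
      b (simplexChain (K.δ 0 σ)) - b (simplexChain (K.δ 1 σ)) := by
  refine (congrArg b (d_simplexChain σ)).trans ?_
  simp [Fin.sum_univ_two, sub_eq_add_neg]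

end Cochains

/-! ### Singular 1-cocycles and the dual of `H_1`. -/

section Singular

open CategoryTheory Simplicial Opposite

variable {X : Type u} [TopologicalSpace X]

/-- The faces `δ 1`, `δ 2`, `δ 0` of a triangle are the edges 02, 01, 12, so the cocycle condition
is additivity along 0, 1, 2. -/
theorem mem_singularCocycles_one (c : Module.Dual ℚ ((singularChains X).X 1)) :
    c ∈ singularCocycles X 1 ↔ ∀ σ : (TopCat.toSSet.obj (TopCat.of X)) _⦋2⦌,
      c (simplexChain ((TopCat.toSSet.obj (TopCat.of X)).δ 1 σ)) =
        c (simplexChain ((TopCat.toSSet.obj (TopCat.of X)).δ 2 σ)) +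
          c (simplexChain ((TopCat.toSSet.obj (TopCat.of X)).δ 0 σ)) := by
  have h := dual_d_two (K := TopCat.toSSet.obj (TopCat.of X)) c
  constructor
  · intro hc σ
    have h1 := (h σ).symm.trans (congrArg (fun f => f (simplexChain σ)) (LinearMap.mem_ker.1 hc))
    exact (by intro a b c (h : a - b + c = 0); linarith :
      ∀ {a b c : ℚ}, a - b + c = 0 → b = c + a) h1
  · intro hc
    refine LinearMap.mem_ker.2 (dual_ext (K := TopCat.toSSet.obj (TopCat.of X)) fun σ => ?_)
    refine (h σ).trans ?_
    exact (by intro a b c h; rw [h]; ring : ∀ {a b c : ℚ}, b = c + a → a - b + c = 0) (hc σ)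

theorem mem_singularCoboundaries_one (c : Module.Dual ℚ ((singularChains X).X 1)) :
    c ∈ singularCoboundaries X 1 ↔
      ∃ g : (TopCat.toSSet.obj (TopCat.of X)) _⦋0⦌ → ℚ,
        ∀ σ : (TopCat.toSSet.obj (TopCat.of X)) _⦋1⦌, c (simplexChain σ) =
          g ((TopCat.toSSet.obj (TopCat.of X)).δ 0 σ) -
            g ((TopCat.toSSet.obj (TopCat.of X)).δ 1 σ) := by
  have h := dual_d_one (K := TopCat.toSSet.obj (TopCat.of X))
  constructor
  · rintro ⟨b, rfl⟩
    exact ⟨fun p => b (simplexChain p), fun σ => h b σ⟩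
  · rintro ⟨g, hg⟩
    refine ⟨cochain _ 0 g, dual_ext (K := TopCat.toSSet.obj (TopCat.of X)) fun σ => ?_⟩
    refine (h (cochain _ 0 g) σ).trans ?_
    exact (congrArg₂ (· - ·) (cochain_simplexChain g _) (cochain_simplexChain g _)).trans
      (hg σ).symm

/-- A linear map out of the singular cocycles whose kernel consists of coboundaries yields an
injection out of singular cohomology. -/
theorem exists_injective_of_ker_le {W : Type*} [AddCommGroup W] [Module ℚ W] {n : ℕ}
    (f : singularCocycles X n →ₗ[ℚ] W)
    (hf : ∀ c, f c = 0 → (c : Module.Dual ℚ _) ∈ singularCoboundaries X n) :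
    ∃ g : singularCohomology X n →ₗ[ℚ] W, Function.Injective g := by
  obtain ⟨s, hs⟩ := ((singularCoboundaries X n).submoduleOf (singularCocycles X n)).mkQ
    |>.exists_rightInverse_of_surjective (Submodule.range_mkQ _)
  -- No descent of `f` to the quotient is required: it is precomposed with a linear section `s`, and
  -- if `f (s h) = 0` then `s h` is a coboundary, so `h = 0`.
  refine ⟨f ∘ₗ s, (injective_iff_map_eq_zero _).2 fun h hh => ?_⟩
  rw [← LinearMap.id_apply (R := ℚ) h, ← hs]
  exact (Submodule.Quotient.mk_eq_zero _).2 (hf _ hh)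

/-- The injection of `Hom(H_1, ℚ)` into `H^1` (universal coefficients). -/
theorem exists_injective_dual_homology :
    ∃ f : Module.Dual ℚ (singularHomology X 1) →ₗ[ℚ] singularCohomology X 1,
      Function.Injective f := by
  let C := singularChains X
  -- `r` retracts `C_1 / B_1` onto its subspace `H_1`; a functional `l` on `H_1` thus extends to
  -- `C_1 / B_1`, and its pullback to `C_1` is a cocycle.
  obtain ⟨r, hr⟩ := (C.homologyι 1).hom.exists_leftInverse_of_injective
    (LinearMap.ker_eq_bot.2 ((ModuleCat.mono_iff_injective _).1 inferInstance))
  have hd : (C.pOpcycles 1).hom ∘ₗ (C.d 2 1).hom = 0 := by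
    rw [← ModuleCat.hom_comp, C.d_pOpcycles]; rfl
  let F : Module.Dual ℚ (singularHomology X 1) →ₗ[ℚ] singularCocycles X 1 :=
    LinearMap.codRestrict _ (LinearMap.dualMap (r ∘ₗ (C.pOpcycles 1).hom)) (fun l => by
      refine LinearMap.mem_ker.2 (LinearMap.ext fun x => ?_)
      have hx := congrArg (fun f => l (r (f x))) hd
      exact hx.trans ((congrArg l (map_zero r)).trans (map_zero l)))
  refine ⟨Submodule.mkQ _ ∘ₗ F, (injective_iff_map_eq_zero _).2 fun l hl => ?_⟩
  obtain ⟨b, hb⟩ : (F l : Module.Dual ℚ (C.X 1)) ∈ singularCoboundaries X 1 :=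
    (Submodule.Quotient.mk_eq_zero ((singularCoboundaries X 1).submoduleOf _)).1 hl
  refine LinearMap.ext fun h => ?_
  -- On a cycle `z` the cocycle of `l` takes the value `l [z]`, while a coboundary takes the value
  -- `b (dz) = 0`.
  obtain ⟨z, rfl⟩ := (ModuleCat.epi_iff_surjective (C.homologyπ 1)).1 inferInstance h
  have h1 : (C.homologyι 1).hom ((C.homologyπ 1).hom z) =
      (C.pOpcycles 1).hom ((C.iCycles 1).hom z) := by
    exact congrArg (fun f => f.hom z) (C.homology_π_ι 1)
  have h2 : (C.d 1 0).hom ((C.iCycles 1).hom z) = 0 := by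
    exact congrArg (fun f => f.hom z) (C.iCycles_d 1 0)
  have h3 := congrArg (fun f => f ((C.iCycles 1).hom z)) hb
  have h4 : b ((C.d 1 0).hom ((C.iCycles 1).hom z)) =
    l (r ((C.pOpcycles 1).hom ((C.iCycles 1).hom z))) := h3
  rw [h2, map_zero, ← h1] at h4
  have h5 := congrArg (fun f => f ((C.homologyπ 1).hom z)) hr
  simp only [LinearMap.comp_apply, LinearMap.id_apply] at h5
  rw [h5] at h4
  exact h4.symm

end Singular

/-! ### Polynomial forms on the interval -/

namespace PLForms

/-- Evaluation of forms on the point. -/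
def evalPoint : PLForms 0 →ₐ[ℚ] ℚ :=
  lift (Sum.elim (fun _ => 1) (fun _ => 0)) (by rintro (x | x) (y | y) <;> simp [PLGen.deg])
    (by simp) (by simp)

/-- Forms on the interval in terms of the coordinate `X = t_1`. -/
def intervalMap : PLForms 1 →ₐ[ℚ] DualNumber (Polynomial ℚ) :=
  -- The dual number `a + bε` stands for the form `a + b dX`.
  lift (Sum.elim ![TrivSqZeroExt.inl (1 - Polynomial.X), TrivSqZeroExt.inl Polynomial.X]
      ![TrivSqZeroExt.inr (-1), TrivSqZeroExt.inr 1])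
    (by
      rintro (x | x) (y | y) <;> fin_cases x <;> fin_cases y <;>
        simp [PLGen.deg, mul_comm])
    (by simp [Fin.sum_univ_two])
    (by simp [Fin.sum_univ_two])

/-- The `(0, 0)` entry of `dMatrix` is `a` with its degree-`k` part multiplied by `(-1)^k`, which
leaves the function part alone. This removes the sign when the Leibniz rule `d_mul'` is applied to
inhomogeneous forms. -/
theorem intervalMap_sign (a : PLForms 1) :
    (intervalMap (dMatrix 1 a 0 0)).fst = (intervalMap a).fst := by
  induction a using induction with
  | h0 r => simp [Matrix.algebraMap_eq_diagonal]
  | ht x => rcases x with i | i <;> fin_cases i <;> simp [dMatrix, intervalMap]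
  | ha a b h1 h2 => simp [h1, h2]
  | hm a b h1 h2 => rw [dMatrix_mul]; simp [h1, h2]

/-- On the interval `d (a + b dX) = a' dX`. It holds on generators and passes to products by the
Leibniz rule. -/
theorem intervalMap_d (a : PLForms 1) :
    intervalMap (d 1 a) = TrivSqZeroExt.inr (intervalMap a).fst.derivative := by
  induction a using induction with
  | h0 r =>
    rw [d_algebraMap, map_zero, AlgHom.commutes]
    simp [Algebra.algebraMap_eq_smul_one]
  | ht x => rcases x with i | i <;> fin_cases i <;> simp [intervalMap]
  | ha a b h1 h2 => simp only [map_add, h1, h2, TrivSqZeroExt.fst_add, TrivSqZeroExt.inr_add]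
  | hm a b h1 h2 =>
    rw [d_mul', map_add, map_mul, map_mul, h1, h2]
    ext <;> simp [intervalMap_sign, Polynomial.derivative_mul, mul_comm]

/-- The coordinate `X = t_1` equals `i` at the vertex `i`, and pulling back to a point discards
`dX`. -/
theorem evalPoint_pull (i : Fin 2) (θ : Fin 1 → Fin 2) (hθ : θ 0 = i) (a : PLForms 1) :
    evalPoint (pull θ a) = (intervalMap a).fst.eval (i : ℚ) := by
  induction a using induction with
  | h0 r => simp [TrivSqZeroExt.algebraMap_eq_inl']
  | ht x =>
    rcases x with j | j <;> fin_cases j <;> fin_cases i <;>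
      simp_all [intervalMap, pull, evalPoint, Finset.sum_filter]
  | ha a b h1 h2 => simp [h1, h2]
  | hm a b h1 h2 => simp [h1, h2]

/-- The fundamental theorem of calculus for forms with constant differential. -/
theorem evalPoint_sub (θ₀ θ₁ : Fin 1 → Fin 2) (h₀ : θ₀ 0 = 0) (h₁ : θ₁ 0 = 1) (a : PLForms 1)
    (r : ℚ) (ha : d 1 a = r • dt 1) : evalPoint (pull θ₁ a) - evalPoint (pull θ₀ a) = r := by
  have h := intervalMap_d a
  rw [ha, map_smul] at h
  have h2 : (intervalMap a).fst.derivative = Polynomial.C r := by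
    have h1 : intervalMap (dt 1) = TrivSqZeroExt.inr 1 := by simp [intervalMap]
    rw [h1] at h
    refine (congrArg TrivSqZeroExt.snd h).symm.trans ?_
    simp [Polynomial.smul_eq_C_mul]
  have h3 : ((intervalMap a).fst - Polynomial.C r * Polynomial.X).derivative = 0 := by
    simp [h2]
  obtain ⟨s, hs⟩ : ∃ s, (intervalMap a).fst - Polynomial.C r * Polynomial.X = Polynomial.C s :=
    ⟨_, Polynomial.eq_C_of_derivative_eq_zero h3⟩
  rw [evalPoint_pull 1 θ₁ h₁, evalPoint_pull 0 θ₀ h₀, eq_add_of_sub_eq hs]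
  simp

end PLForms

/-! ### The form attached to a `1`-cocycle -/

section CocycleForm

open CategoryTheory Simplicial Opposite SimplexCategory

variable {K : SSet.{u}}

/-- The edge from the `i`-th vertex to the `j`-th vertex of a simplex. -/
def edge {n : SimplexCategoryᵒᵖ} (σ : K.obj n) (i j : Fin (n.unop.len + 1)) (h : i ≤ j) : K _⦋1⦌ :=
  K.map (Quiver.Hom.op (show ⦋1⦌ ⟶ n.unop from mkOfLe i j h)) σ

theorem edge_map {m n : SimplexCategoryᵒᵖ} (θ : m ⟶ n) (σ : K.obj m)
    (i j : Fin (n.unop.len + 1)) (h : i ≤ j) :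
    edge (K.map θ σ) i j h =
      edge σ (θ.unop.toOrderHom i) (θ.unop.toOrderHom j) (θ.unop.toOrderHom.monotone h) := by
  unfold edge
  rw [← ConcreteCategory.comp_apply, ← K.map_comp]
  refine congrArg (fun φ => K.map φ σ) (Quiver.Hom.unop_inj ?_)
  ext k : 3
  fin_cases k <;> rfl

/-- This is the cocycle condition on the triangle of `σ` with vertices `i ≤ j ≤ k`. Degenerate
triangles are allowed, which is what forces `c` to vanish on degenerate edges. -/
theorem edge_add {c : K _⦋1⦌ → ℚ}
    (hc : ∀ τ : K _⦋2⦌, c (K.δ 1 τ) = c (K.δ 2 τ) + c (K.δ 0 τ)) {n : SimplexCategoryᵒᵖ}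
    (σ : K.obj n) (i j k : Fin (n.unop.len + 1)) (h₁ : i ≤ j) (h₂ : j ≤ k) :
    c (edge σ i k (h₁.trans h₂)) = c (edge σ i j h₁) + c (edge σ j k h₂) := by
  have key : ∀ (l : Fin 3) (a b : Fin (n.unop.len + 1)) (h : a ≤ b),
      (SimplexCategory.δ l ≫ mkOfLeComp i j k h₁ h₂ : ⦋1⦌ ⟶ ⦋n.unop.len⦌) = mkOfLe a b h →
      K.δ l (K.map (Quiver.Hom.op (show ⦋2⦌ ⟶ n.unop from mkOfLeComp i j k h₁ h₂)) σ) =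
        edge σ a b h := by
    intro l a b h hl
    unfold edge SimplicialObject.δ
    rw [← hl, ← ConcreteCategory.comp_apply, ← K.map_comp]
    rfl
  have h := hc (K.map (Quiver.Hom.op (show ⦋2⦌ ⟶ n.unop from mkOfLeComp i j k h₁ h₂)) σ)
  rw [key 0 j k h₂, key 1 i k (h₁.trans h₂), key 2 i j h₁] at h
  · exact h
  all_goals
    ext l : 3
    fin_cases l <;> rfl

/-- The form `∑ c(σ_{0j}) dt_j` on the simplex `σ`. -/
def cocycleForm (c : K _⦋1⦌ → ℚ) : APL.Family K :=
  fun n σ => ∑ j : Fin (n.unop.len + 1), c (edge σ 0 j (Fin.zero_le _)) • PLForms.dt j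

/-- A simplicial operator may move the base vertex 0. By additivity this changes all coefficients by
the same constant, and `∑ dt_j = 0` removes that constant. -/
theorem cocycleForm_mem {c : K _⦋1⦌ → ℚ}
    (hc : ∀ τ : K _⦋2⦌, c (K.δ 1 τ) = c (K.δ 2 τ) + c (K.δ 0 τ)) :
    cocycleForm c ∈ APL.form K 1 := by
  refine ⟨fun n σ => Submodule.sum_mem _ fun j _ => Submodule.smul_mem _ _
    (PLForms.gen_mem_deg (Sum.inr j)), fun m n θ σ => ?_⟩
  have h1 : ∀ j : Fin (n.unop.len + 1), c (edge (K.map θ σ) 0 j (Fin.zero_le _)) =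
      c (edge σ 0 (θ.unop.toOrderHom j) (Fin.zero_le _)) -
        c (edge σ 0 (θ.unop.toOrderHom 0) (Fin.zero_le _)) := fun j => by
    rw [edge_map, edge_add hc σ 0 (θ.unop.toOrderHom 0) (θ.unop.toOrderHom j) (Fin.zero_le _)
      (θ.unop.toOrderHom.monotone (Fin.zero_le j))]
    ring
  simp only [cocycleForm, h1, sub_smul, Finset.sum_sub_distrib, ← Finset.smul_sum,
    PLForms.sum_dt, smul_zero, sub_zero, map_sum, map_smul]
  simp only [PLForms.pull, PLForms.lift_dt, Sum.elim_inr, Finset.smul_sum]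
  rw [← Finset.sum_fiberwise Finset.univ (fun j => θ.unop.toOrderHom j)]
  refine Finset.sum_congr rfl fun k _ => Finset.sum_congr rfl fun j hj => ?_
  obtain rfl : θ.unop.toOrderHom j = k := (Finset.mem_filter.1 hj).2
  rfl

theorem cocycleForm_add (c c' : K _⦋1⦌ → ℚ) :
    cocycleForm (fun σ => c σ + c' σ) = cocycleForm c + cocycleForm c' := by
  funext n σ
  simp [cocycleForm, add_smul, Finset.sum_add_distrib]

theorem cocycleForm_smul (r : ℚ) (c : K _⦋1⦌ → ℚ) :
    cocycleForm (fun σ => r * c σ) = r • cocycleForm c := by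
  funext n σ
  simp [cocycleForm, mul_smul, Finset.smul_sum]

theorem dFamily_cocycleForm (c : K _⦋1⦌ → ℚ) : APL.dFamily K (cocycleForm c) = 0 := by
  funext n σ
  change PLForms.d _ (∑ j, _) = 0
  simp

theorem total_map {f : APL.Family K} (hf : f ∈ APL.total K) {m n : SimplexCategoryᵒᵖ}
    (θ : m ⟶ n) (σ : K.obj m) :
    f n (K.map θ σ) = PLForms.pull (fun i => θ.unop.toOrderHom i) (f m σ) := by
  refine APL.total_induction K
    (p := fun f => f n (K.map θ σ) = PLForms.pull (fun i => θ.unop.toOrderHom i) (f m σ))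
    (by simp) (fun k Φ h => h.2 m n θ σ) (fun Φ Ψ h1 h2 => ?_) hf
  simp [h1, h2]

theorem edge_zero_one (σ : K _⦋1⦌) : edge σ 0 1 (Fin.zero_le _) = σ := by
  have : (mkOfLe (0 : Fin 2) 1 (Fin.zero_le _) : ⦋1⦌ ⟶ ⦋1⦌) = 𝟙 _ := by
    ext k : 3
    fin_cases k <;> rfl
  unfold edge
  exact (congrArg (fun θ : ⦋1⦌ ⟶ ⦋1⦌ => K.map θ.op σ) this).trans (by simp)

/-- Cocycles vanish on degenerate edges. -/
theorem edge_zero_zero {c : K _⦋1⦌ → ℚ}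
    (hc : ∀ τ : K _⦋2⦌, c (K.δ 1 τ) = c (K.δ 2 τ) + c (K.δ 0 τ)) {n : SimplexCategoryᵒᵖ}
    (σ : K.obj n) (i : Fin (n.unop.len + 1)) : c (edge σ i i le_rfl) = 0 := by
  have := edge_add hc σ i i i le_rfl le_rfl
  linarith

/-- A cocycle whose form is exact is a coboundary. -/
theorem exists_of_cocycleForm_eq {c : K _⦋1⦌ → ℚ}
    (hc : ∀ τ : K _⦋2⦌, c (K.δ 1 τ) = c (K.δ 2 τ) + c (K.δ 0 τ)) {f : APL.Family K}
    (hf : f ∈ APL.total K) (h : APL.dFamily K f = cocycleForm c) :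
    ∃ g : K _⦋0⦌ → ℚ, ∀ σ : K _⦋1⦌, c σ = g (K.δ 0 σ) - g (K.δ 1 σ) := by
  -- The primitive `f` is restricted to vertices. It need not be homogeneous, since `evalPoint`
  -- kills positive degrees. On an edge `df = c(σ) dt_1`, the `dt_0` term having coefficient zero,
  -- so the difference of the end values is `c(σ)`.
  refine ⟨fun p => PLForms.evalPoint (f (op ⦋0⦌) p), fun σ => ?_⟩
  have h1 : PLForms.d 1 (f (op ⦋1⦌) σ) = c σ • PLForms.dt 1 := by
    refine (congrFun (congrFun h (op ⦋1⦌)) σ).trans ?_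
    change ∑ j : Fin 2, c (edge σ 0 j (Fin.zero_le _)) • PLForms.dt j = _
    rw [Fin.sum_univ_two]
    have h0 : c (edge σ 0 0 (Fin.zero_le _)) = 0 := edge_zero_zero hc σ 0
    rw [h0, edge_zero_one, zero_smul, zero_add]
  have h2 : ∀ i : Fin 2, f (op ⦋0⦌) (K.δ i σ) =
      PLForms.pull (fun j => (SimplexCategory.δ i : ⦋0⦌ ⟶ ⦋1⦌).toOrderHom j) (f (op ⦋1⦌) σ) :=
    fun i => total_map hf (SimplexCategory.δ i : ⦋0⦌ ⟶ ⦋1⦌).op σ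
  dsimp only
  rw [h2, h2]
  exact (PLForms.evalPoint_sub _ _ rfl rfl _ _ h1).symm

end CocycleForm

/-! ### Comparison of singular and polynomial cohomology in degree one. -/

section DeRham

variable {X : Type u} [TopologicalSpace X]

/-- The injection `H^1(X; ℚ) → H^1(A_PL(X))`. -/
theorem exists_injective_APL :
    ∃ f : singularCohomology X 1 →ₗ[ℚ] (APLSpace X).H 1, Function.Injective f := by
  let K : SSet.{u} := TopCat.toSSet.obj (TopCat.of X)
  have hc : ∀ c : singularCocycles X 1, ∀ τ, _ := fun c =>
    (mem_singularCocycles_one (c : Module.Dual ℚ ((singularChains X).X 1))).1 c.2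
  have hm : ∀ c : singularCocycles X 1,
      (cocycleForm (K := K) fun σ => c.1 (simplexChain σ)) ∈ APL.form K 1 := fun c =>
    cocycleForm_mem (K := K) (c := fun σ => c.1 (simplexChain σ)) (hc c)
  have hd : ∀ c : singularCocycles X 1, (APLSpace X).d ⟨_, APL.form_le_total K (hm c)⟩ = 0 :=
    fun c => Subtype.ext (dFamily_cocycleForm (K := K) fun σ => c.1 (simplexChain σ))
  let F : singularCocycles X 1 →ₗ[ℚ] (APLSpace X).cocycles 1 :=
    { toFun := fun c => ⟨⟨cocycleForm (K := K) fun σ => c.1 (simplexChain σ),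
          APL.form_le_total K (hm c)⟩, hm c, hd c⟩
      map_add' := fun c c' => Subtype.ext <| Subtype.ext <|
        cocycleForm_add (K := K) (fun σ => c.1 (simplexChain σ)) fun σ => c'.1 (simplexChain σ)
      map_smul' := fun r c => Subtype.ext <| Subtype.ext <|
        cocycleForm_smul (K := K) r fun σ => c.1 (simplexChain σ) }
  refine exists_injective_of_ker_le (Submodule.mkQ _ ∘ₗ F) fun c h => ?_
  obtain ⟨f, hf⟩ := (Submodule.Quotient.mk_eq_zero
    ((LinearMap.range (APLSpace X).d).submoduleOf _)).1 h
  refine (mem_singularCoboundaries_one _).2 ?_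
  exact exists_of_cocycleForm_eq (K := K) (hc c) f.2 (congrArg Subtype.val hf)

end DeRham

/-! ### The abelianized fundamental Lie algebra in terms of cohomology -/

namespace MinimalSullivanAlgebra

variable (M : MinimalSullivanAlgebra.{u})

/-- Letters of degree 0 vanish because `V^0 = 0`, and a word of total degree 1 in letters of
positive degree is a single letter. -/
theorem word_one (l : List (Σ i, M.V i)) (hs : (l.map Sigma.fst).sum = 1) :
    (l.map (FreeGCA.gen M.V)).prod ∈ LinearMap.range (FreeGCA.incl M.V 1) := by
  have := M.pos
  by_cases h0 : ∃ x ∈ l, x.1 = 0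
  · obtain ⟨⟨i, v⟩, hx, rfl⟩ := h0
    have : (l.map (FreeGCA.gen M.V)).prod = 0 := by
      obtain ⟨s, t, rfl⟩ := List.append_of_mem hx
      have hv : v = 0 := Subsingleton.elim _ _
      simp [FreeGCA.gen, hv]
    rw [this]
    exact zero_mem _
  · push Not at h0
    match l, hs, h0 with
    | [⟨i, v⟩], hs, h0 =>
      simp only [List.map_cons, List.map_nil, List.sum_cons, List.sum_nil] at hs
      obtain rfl : i = 1 := by omega
      exact ⟨v, by simp [FreeGCA.gen]⟩
    | x :: y :: l, hs, h0 =>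
      have hx := h0 x (by simp)
      have hy := h0 y (by simp)
      simp only [List.map_cons, List.sum_cons] at hs
      omega

theorem deg_one_le : FreeGCA.deg M.V 1 ≤ LinearMap.range (FreeGCA.incl M.V 1) := by
  refine Submodule.span_le.2 ?_
  rintro _ ⟨l, hl, rfl⟩
  exact M.word_one l hl

/-- The cocycles in `V^1`. -/
def closedGens : Submodule ℚ (M.V 1) := LinearMap.ker (M.d ∘ₗ FreeGCA.incl M.V 1)

/-- Every degree-one cocycle of `ΛV` lies in `V^1` by `deg_one_le`. Surjectivity suffices, since a
linear section will be dualized. -/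
theorem exists_surjective_closedGens :
    ∃ f : M.closedGens →ₗ[ℚ] M.toCDGA.H 1, Function.Surjective f := by
  let G : M.closedGens →ₗ[ℚ] M.toCDGA.cocycles 1 :=
    LinearMap.codRestrict _ (FreeGCA.incl M.V 1 ∘ₗ M.closedGens.subtype)
      fun v => ⟨M.incl_mem 1 v, v.2⟩
  refine ⟨Submodule.mkQ _ ∘ₗ G, (Submodule.mkQ_surjective _).comp ?_⟩
  rintro ⟨a, ha, hd⟩
  obtain ⟨v, rfl⟩ := M.deg_one_le ha
  exact ⟨⟨v, hd⟩, rfl⟩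

/-- Restriction of functionals to the cocycles in `V^1` factors through the abelianization. -/
theorem exists_surjective_dual_closedGens :
    ∃ f : M.LieAbelianization →ₗ[ℚ] Module.Dual ℚ M.closedGens, Function.Surjective f := by
  let R : M.FundamentalLieAlgebra →ₗ[ℚ] Module.Dual ℚ M.closedGens :=
    M.closedGens.subtype.dualMap
  have hR : Function.Surjective R :=
    LinearMap.dualMap_surjective_of_injective M.closedGens.injective_subtype
  refine ⟨Submodule.liftQ _ R ?_, ?_⟩
  -- The derived ideal is the linear span of brackets, and `[x, y]` at a closed `v` is the pairing
  -- of `dv = 0` with `x, y`.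
  · rw [LieSubmodule.lieIdeal_oper_eq_linear_span', Submodule.span_le]
    rintro _ ⟨x, -, y, -, rfl⟩
    refine LinearMap.ext fun v => ?_
    change M.pairing x y (M.d (FreeGCA.incl M.V 1 v)) = 0
    have hv : M.d (FreeGCA.incl M.V 1 v) = 0 := v.2
    rw [hv, map_zero]
  · exact fun y => (hR y).imp' (Submodule.mkQ _) fun x hx => hx

end MinimalSullivanAlgebra

/-! ### Values of a functional on the fundamental group along paths -/

section GroupoidValue

open CategoryTheory

variable {G : Type*} [Groupoid G] (x₀ : G) {T : Type*} [AddCommGroup T] (ψ : (x₀ ⟶ x₀) → T)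

open scoped Classical in
/-- The extension of a function on the vertex group of `x₀` to all morphisms, by conjugation with
chosen morphisms from `x₀`; zero outside of the component of `x₀`. -/
def groupoidValue {a b : G} (q : a ⟶ b) : T :=
  if h : Nonempty (x₀ ⟶ a) then
    ψ (h.some ≫ q ≫ inv (Nonempty.intro (h.some ≫ q) : Nonempty (x₀ ⟶ b)).some) else 0

variable {ψ} (hψ : ∀ f g, ψ (f ≫ g) = ψ f + ψ g)
include hψ

/-- The chosen morphism from `x₀` to `b` depends only on `b`, by proof irrelevance, so the one
closing `q` cancels the one opening `r`. Outside the component of `x₀` all three values are zero. -/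
theorem groupoidValue_comp {a b c : G} (q : a ⟶ b) (r : b ⟶ c) :
    groupoidValue x₀ ψ (q ≫ r) = groupoidValue x₀ ψ q + groupoidValue x₀ ψ r := by
  by_cases h : Nonempty (x₀ ⟶ a)
  · have h' : Nonempty (x₀ ⟶ b) := ⟨h.some ≫ q⟩
    rw [groupoidValue, groupoidValue, groupoidValue, dif_pos h, dif_pos h, dif_pos h', ← hψ]
    simp
  · have h' : ¬ Nonempty (x₀ ⟶ b) := fun ⟨e⟩ => h ⟨e ≫ inv q⟩
    rw [groupoidValue, groupoidValue, groupoidValue, dif_neg h, dif_neg h, dif_neg h', add_zero]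

/-- At `x₀` the extension conjugates by a chosen loop, which is invisible in the commutative group
`T`. -/
theorem groupoidValue_loop (q : x₀ ⟶ x₀) : groupoidValue x₀ ψ q = ψ q := by
  have h : Nonempty (x₀ ⟶ x₀) := ⟨𝟙 _⟩
  have h1 : ψ (h.some ≫ inv h.some) = 0 := by
    have := hψ (𝟙 x₀) (𝟙 x₀)
    rw [IsIso.hom_inv_id]
    simpa using this
  rw [groupoidValue, dif_pos h, hψ, hψ, add_left_comm, ← hψ, h1, add_zero]

end GroupoidValue

/-! ### The singular 1-cocycle of an additive function on the fundamental group. -/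

section PathValue

open CategoryTheory Simplicial Opposite

variable {X : Type u} [TopologicalSpace X] (x₀ : X) {T : Type*} [AddCommGroup T]
  (ψ : FundamentalGroup X x₀ → T)

/-- The value along a path of a function on the fundamental group. -/
def pathValue {a b : X} (p : Path a b) : T :=
  groupoidValue (FundamentalGroupoid.mk x₀) ψ
    (show FundamentalGroupoid.mk a ⟶ FundamentalGroupoid.mk b from Path.Homotopic.Quotient.mk p)

/-- The endpoints may differ syntactically; this avoids casts between path types. -/
theorem pathValue_congr {a b a' b' : X} (p : Path a b) (q : Path a' b') (h : ∀ t, p t = q t) :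
    pathValue x₀ ψ p = pathValue x₀ ψ q := by
  obtain rfl : a = a' := by simpa using h 0
  obtain rfl : b = b' := by simpa using h 1
  rw [Path.ext (funext h)]

/-- Paths in a simply connected space with common endpoints are homotopic. Hence the choice of
`somePath` in `simplexValue` is immaterial. -/
theorem pathValue_map_eq {Y : Type*} [TopologicalSpace Y] [SimplyConnectedSpace Y] (f : C(Y, X))
    {a b a' b' : Y} (p : Path a b) (q : Path a' b') (ha : a = a') (hb : b = b') :
    pathValue x₀ ψ (p.map f.continuous) = pathValue x₀ ψ (q.map f.continuous) := by
  subst ha hb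
  have h : Path.Homotopic (p.map f.continuous) (q.map f.continuous) :=
    (SimplyConnectedSpace.paths_homotopic p q).map f
  exact congrArg (groupoidValue _ ψ) (Quotient.sound h)

instance simplyConnectedSpace_stdSimplex (n : ℕ) :
    SimplyConnectedSpace (stdSimplex ℝ (Fin (n + 1))) := by
  have := (convex_stdSimplex ℝ (Fin (n + 1))).contractibleSpace
    ⟨_, (stdSimplex.vertex (S := ℝ) (0 : Fin (n + 1))).2⟩
  infer_instance

/-- The continuous map underlying a singular simplex. -/
def simplexMap {n : ℕ} (σ : (TopCat.toSSet.obj (TopCat.of X)) _⦋n⦌) :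
    C(stdSimplex ℝ (Fin (n + 1)), X) :=
  TopCat.toSSetObjEquiv (TopCat.of X) (op ⦋n⦌) σ

theorem simplexMap_δ {n : ℕ} (i : Fin (n + 2))
    (σ : (TopCat.toSSet.obj (TopCat.of X)) _⦋n + 1⦌) (s : stdSimplex ℝ (Fin (n + 1))) :
    simplexMap ((TopCat.toSSet.obj (TopCat.of X)).δ i σ) s =
      simplexMap σ (stdSimplex.map (fun j => (SimplexCategory.δ i : ⦋n⦌ ⟶ ⦋n + 1⦌).toOrderHom j) s) :=
  rfl

/-- The value on a singular `1`-simplex of a function on the fundamental group. -/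
def simplexValue (σ : (TopCat.toSSet.obj (TopCat.of X)) _⦋1⦌) : T :=
  pathValue x₀ ψ ((PathConnectedSpace.somePath (stdSimplex.vertex (S := ℝ) (0 : Fin 2))
    (stdSimplex.vertex 1)).map (simplexMap σ).continuous)

/-- The face inclusion carries the vertices 0, 1 to `a`, `b`, and inside the triangle only the
endpoints of a path matter. -/
theorem simplexValue_δ (i : Fin 3) (a b : Fin 3) (ha : i.succAbove 0 = a)
    (hb : i.succAbove 1 = b) (σ : (TopCat.toSSet.obj (TopCat.of X)) _⦋2⦌) :
    simplexValue x₀ ψ ((TopCat.toSSet.obj (TopCat.of X)).δ i σ) =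
      pathValue x₀ ψ ((PathConnectedSpace.somePath (stdSimplex.vertex (S := ℝ) a)
        (stdSimplex.vertex b)).map (simplexMap σ).continuous) := by
  let p := PathConnectedSpace.somePath (stdSimplex.vertex (S := ℝ) (0 : Fin 2))
    (stdSimplex.vertex 1)
  refine (pathValue_congr x₀ ψ _ ((p.map (stdSimplex.continuous_map (X := Fin 2) (Y := Fin 3)
    i.succAbove)).map (simplexMap σ).continuous) fun t => ?_).trans
    (pathValue_map_eq x₀ ψ _ _ _ ?_ ?_)
  · exact simplexMap_δ i σ _
  · rw [stdSimplex.map_vertex, ha]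
  · rw [stdSimplex.map_vertex, hb]

/-- The singular `1`-simplex of a path. -/
def pathSimplex {a b : X} (p : Path a b) : (TopCat.toSSet.obj (TopCat.of X)) _⦋1⦌ :=
  (TopCat.toSSetObjEquiv (TopCat.of X) (op ⦋1⦌)).symm
    (p.toContinuousMap.comp (stdSimplexHomeomorphUnitInterval : C(_, _)))

theorem simplexMap_pathSimplex {a b : X} (p : Path a b) (s : stdSimplex ℝ (Fin 2)) :
    simplexMap (pathSimplex p) s = p (stdSimplexHomeomorphUnitInterval s) :=
  congrArg (fun f : C(stdSimplex ℝ (Fin 2), X) => f s)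
    ((TopCat.toSSetObjEquiv (TopCat.of X) (op ⦋1⦌)).apply_symm_apply _)

theorem simplexValue_pathSimplex {a b : X} (p : Path a b) :
    simplexValue x₀ ψ (pathSimplex p) = pathValue x₀ ψ p := by
  -- The inverse homeomorphism is a path between the two vertices of the simplex; composing it with
  -- the simplex of `p` returns `p`.
  let q : Path (stdSimplexHomeomorphUnitInterval.symm 0)
      (stdSimplexHomeomorphUnitInterval.symm 1) :=
    { toFun := stdSimplexHomeomorphUnitInterval.symm
      continuous_toFun := stdSimplexHomeomorphUnitInterval.symm.continuous
      source' := rfl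
      target' := rfl }
  refine (pathValue_map_eq x₀ ψ _ _ q ?_ ?_).trans (pathValue_congr x₀ ψ _ _ fun t => ?_)
  · rw [Homeomorph.eq_symm_apply]
    ext; simp
  · rw [Homeomorph.eq_symm_apply]
    ext; simp
  · refine (simplexMap_pathSimplex p _).trans ?_
    exact congrArg p (stdSimplexHomeomorphUnitInterval.apply_symm_apply t)

/-- Both faces are the base point of the loop, so coboundaries vanish on this simplex. -/
theorem δ_pathSimplex_loop {a : X} (p : Path a a) :
    (TopCat.toSSet.obj (TopCat.of X)).δ 0 (pathSimplex p) =
      (TopCat.toSSet.obj (TopCat.of X)).δ 1 (pathSimplex p) := by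
  apply (TopCat.toSSetObjEquiv (TopCat.of X) (op ⦋0⦌)).injective
  refine ContinuousMap.ext fun s => ?_
  obtain rfl : s = stdSimplex.vertex (0 : Fin 1) := Subsingleton.elim _ _
  have h : ∀ i : Fin 2, simplexMap ((TopCat.toSSet.obj (TopCat.of X)).δ i (pathSimplex p))
      (stdSimplex.vertex (0 : Fin 1)) = a := fun i => by
    rw [simplexMap_δ, simplexMap_pathSimplex, stdSimplex.map_vertex]
    fin_cases i
    · exact (congrArg p stdSimplexHomeomorphUnitInterval_one).trans p.target
    · exact (congrArg p stdSimplexHomeomorphUnitInterval_zero).trans p.source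
  exact (h 0).trans (h 1).symm

variable {ψ} (hψ : ∀ f g, ψ (f * g) = ψ f + ψ g)
include hψ

theorem pathValue_trans {a b c : X} (p : Path a b) (q : Path b c) :
    pathValue x₀ ψ (p.trans q) = pathValue x₀ ψ p + pathValue x₀ ψ q :=
  -- Composition of loops is multiplication in the opposite order; commutativity of `T` absorbs the
  -- reversal.
  groupoidValue_comp (FundamentalGroupoid.mk x₀) (fun f g => (hψ g f).trans (add_comm _ _))
    (show FundamentalGroupoid.mk a ⟶ FundamentalGroupoid.mk b from Path.Homotopic.Quotient.mk p)
    (show FundamentalGroupoid.mk b ⟶ FundamentalGroupoid.mk c from Path.Homotopic.Quotient.mk q)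

theorem pathValue_loop (p : Path x₀ x₀) :
    pathValue x₀ ψ p = ψ (Path.Homotopic.Quotient.mk p) :=
  groupoidValue_loop _ (fun f g => (hψ g f).trans (add_comm _ _)) _

/-- In the simply connected triangle, the path through 0, 1, 2 is homotopic to the one from 0 to 2.
-/
theorem simplexValue_cocycle (σ : (TopCat.toSSet.obj (TopCat.of X)) _⦋2⦌) :
    simplexValue x₀ ψ ((TopCat.toSSet.obj (TopCat.of X)).δ 1 σ) =
      simplexValue x₀ ψ ((TopCat.toSSet.obj (TopCat.of X)).δ 2 σ) +
        simplexValue x₀ ψ ((TopCat.toSSet.obj (TopCat.of X)).δ 0 σ) := by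
  rw [simplexValue_δ x₀ ψ 0 1 2 rfl rfl, simplexValue_δ x₀ ψ 1 0 2 rfl rfl,
    simplexValue_δ x₀ ψ 2 0 1 rfl rfl, ← pathValue_trans x₀ hψ, ← Path.map_trans]
  exact pathValue_map_eq x₀ ψ _ _ _ rfl rfl

end PathValue

/-! ### Functionals on the rationalized abelianized fundamental group. -/

section Hurewicz

variable {X : Type u} [TopologicalSpace X]

/-- The injection of `Hom(π_1(X, x₀), ℚ)` into `H^1(X; ℚ)`. -/
theorem exists_injective_dual_fundamentalGroup (x₀ : X) :
    ∃ f : Module.Dual ℚ (ℚ ⊗[ℤ] Additive (Abelianization (FundamentalGroup X x₀))) →ₗ[ℚ]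
      singularCohomology X 1, Function.Injective f := by
  -- The universal additive function to a rational vector space, which handles all functionals `l`
  -- at once. Here `ℚ` is the left factor, so that it acts on the tensor product.
  let ψ : FundamentalGroup X x₀ → ℚ ⊗[ℤ] Additive (Abelianization (FundamentalGroup X x₀)) :=
    fun γ => 1 ⊗ₜ Additive.ofMul (Abelianization.of γ)
  have hψ : ∀ f g, ψ (f * g) = ψ f + ψ g := fun f g => by
    simp only [ψ, map_mul, ofMul_mul, TensorProduct.tmul_add]
  let E : Module.Dual ℚ (ℚ ⊗[ℤ] Additive (Abelianization (FundamentalGroup X x₀))) →ₗ[ℚ]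
      Module.Dual ℚ ((singularChains X).X 1) :=
    cochain (TopCat.toSSet.obj (TopCat.of X)) 1 ∘ₗ
      LinearMap.pi fun σ => Module.Dual.eval ℚ _ (simplexValue x₀ ψ σ)
  have hE : ∀ l σ, E l (simplexChain σ) = l (simplexValue x₀ ψ σ) := fun l σ =>
    cochain_simplexChain _ σ
  let F := LinearMap.codRestrict (singularCocycles X 1) E fun l => by
    refine (mem_singularCocycles_one _).2 fun σ => ?_
    rw [hE, hE, hE, simplexValue_cocycle x₀ hψ, map_add]
  refine ⟨Submodule.mkQ _ ∘ₗ F, (injective_iff_map_eq_zero _).2 fun l hl => ?_⟩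
  obtain ⟨g, hg⟩ := (mem_singularCoboundaries_one _).1 <| (Submodule.Quotient.mk_eq_zero
    ((singularCoboundaries X 1).submoduleOf (singularCocycles X 1))).1 hl
  -- On the simplex of a loop `γ` the cocycle takes the value `l (ψ γ)` and the coboundary takes the
  -- value zero; the elements `ψ γ` span.
  have h1 : ∀ γ : FundamentalGroup X x₀, l (ψ γ) = 0 := by
    intro γ
    obtain ⟨p, rfl⟩ := Path.Homotopic.Quotient.mk_surjective γ
    have h2 := (hE l (pathSimplex p)).symm.trans (hg (pathSimplex p))
    rwa [δ_pathSimplex_loop, sub_self, simplexValue_pathSimplex, pathValue_loop x₀ hψ] at h2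
  refine LinearMap.ext fun t => ?_
  induction t using TensorProduct.induction_on with
  | zero => simp
  | tmul r a =>
    obtain ⟨γ, rfl⟩ : ∃ γ, Additive.ofMul (Abelianization.of γ) = a :=
      QuotientGroup.mk_surjective a.toMul
    have h2 := congrArg (r * ·) (h1 γ)
    rw [mul_zero, ← smul_eq_mul, ← map_smul, TensorProduct.smul_tmul', smul_eq_mul, mul_one] at h2
    exact h2
  | add s t h1 h2 => rw [map_add, h1, h2, map_add]

end Hurewicz

/-! ### Dimension counts -/

/-- The coordinate functionals of a basis are linearly independent, even when the basis is infinite.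
-/
theorem rank_le_rank_dual (W : Type u) [AddCommGroup W] [Module ℚ W] :
    Module.rank ℚ W ≤ Module.rank ℚ (Module.Dual ℚ W) := by
  obtain ⟨⟨ι, b⟩⟩ := Module.Free.exists_basis (R := ℚ) (M := W)
  classical
  exact LinearMap.rank_le_of_injective _ b.toDual_injective

end RatModel

end

/-! ### Comparison of the dimensions. -/

theorem mainTheorem6 {X : Type u} [TopologicalSpace X] (M : RatModel.MinimalSullivanAlgebra.{v})
    (m : RatModel.CDGA.Hom M.toCDGA (RatModel.APLSpace X)) (hm : m.IsQuasiIso)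
    (hX : ¬ Module.Finite ℚ (RatModel.singularCohomology X 1)) :
    IsEmpty (RatModel.singularHomology X 1 ≃+ M.LieAbelianization) ∧
    (∀ x₀ : X, IsEmpty
      ((Additive (Abelianization (FundamentalGroup X x₀)) ⊗[ℤ] ℚ) ≃+ M.LieAbelianization)) ∧
    (∃ φ : M.LieAbelianization →ₗ[ℚ] Module.Dual ℚ (RatModel.singularCohomology X 1),
      Function.Surjective φ) ∧
    Module.rank ℚ (RatModel.singularHomology X 1) <
      Module.rank ℚ (Module.Dual ℚ (RatModel.singularCohomology X 1)) := by
  have hlt : Module.rank ℚ (RatModel.singularCohomology X 1) <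
      Module.rank ℚ (Module.Dual ℚ (RatModel.singularCohomology X 1)) := by
    -- The Erdős–Kaplansky inequality for infinite-dimensional spaces.
    have h := lift_rank_lt_rank_dual (K := ℚ) (V := RatModel.singularCohomology X 1)
      (by rw [← not_lt, Module.rank_lt_aleph0_iff]; exact hX)
    rwa [Cardinal.lift_id'] at h
  have hsurj : ∃ φ : M.LieAbelianization →ₗ[ℚ] Module.Dual ℚ (RatModel.singularCohomology X 1),
      Function.Surjective φ := by
    obtain ⟨φ, hφ⟩ := M.exists_surjective_dual_closedGens
    obtain ⟨p, hp⟩ := M.exists_surjective_closedGens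
    obtain ⟨s, hs⟩ := p.exists_rightInverse_of_surjective (LinearMap.range_eq_top.2 hp)
    obtain ⟨w, hw⟩ := RatModel.exists_injective_APL (X := X)
    let e := LinearEquiv.ofBijective _ (hm 1)
    have hs' : Function.Injective s :=
      Function.LeftInverse.injective (g := p) fun x => congrArg (fun f => f x) hs
    -- The embedding `H → H^1(A_PL(X)) ≅ H^1(ΛV) → Z` has a surjective dual.
    exact ⟨(s ∘ₗ e.symm.toLinearMap ∘ₗ w).dualMap ∘ₗ φ,
      (LinearMap.dualMap_surjective_of_injective
        (f := s ∘ₗ e.symm.toLinearMap ∘ₗ w) (hs'.comp (e.symm.injective.comp hw))).comp hφ⟩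
  have key : ∀ (W : Type u) [AddCommGroup W] [Module ℚ W],
      (∃ f : Module.Dual ℚ W →ₗ[ℚ] RatModel.singularCohomology X 1, Function.Injective f) →
      Module.rank ℚ W < Module.rank ℚ (Module.Dual ℚ (RatModel.singularCohomology X 1)) :=
    fun W _ _ ⟨f, hf⟩ => ((RatModel.rank_le_rank_dual W).trans
      (LinearMap.rank_le_of_injective f hf)).trans_lt hlt
  have hempty : ∀ (W : Type u) [AddCommGroup W] [Module ℚ W],
      (∃ f : Module.Dual ℚ W →ₗ[ℚ] RatModel.singularCohomology X 1, Function.Injective f) →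
      IsEmpty (W ≃+ M.LieAbelianization) := fun W _ _ hf => ⟨fun e => by
    obtain ⟨φ, hφ⟩ := hsurj
    -- Additive maps of rational vector spaces are linear. Composing with `φ` leaves only `W` and
    -- `H^♯`, both in universe `u`, to compare.
    have hg : Function.Surjective (φ ∘ₗ e.toAddMonoidHom.toRatLinearMap) :=
      hφ.comp e.surjective
    exact (key W hf).not_ge (LinearMap.rank_le_of_surjective _ hg)⟩
  refine ⟨hempty _ RatModel.exists_injective_dual_homology, fun x₀ => ⟨fun e => ?_⟩, hsurj,
    key _ RatModel.exists_injective_dual_homology⟩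
  exact (hempty _ (RatModel.exists_injective_dual_fundamentalGroup x₀)).false
    ((TensorProduct.comm ℤ ℚ (Additive (Abelianization (FundamentalGroup X x₀)))).toAddEquiv.trans e)
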